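/- Let $(M,g,J)$ be a Kähler surface, i.e. a smooth Riemannian $4$-manifold with a smooth orthogonal almost complex structure $J$ ($J^2=-\mathrm{Id}$, $g(JX,JY)=g(X,Y)$) that is parallel for the Levi-Civita connection $\nabla$. Let $R(X,Y)Z=\nabla_X\nabla_YZ-\nabla_Y\nabla_XZ-\nabla_{[X,Y]}Z$ and $R(X,Y,Z,W)=g(R(X,Y)Z,W)$. We say that $(M,g,J)$ is QCH with respect to $\mathcal D$ if $\mathcal D\subset TM$ is a smooth $2$-dimensional $J$-invariant distribution such that, for every $x\in M$ and every unit vector $X\in T_xM$, the holomorphic curvature $R(X,JX,JX,X)$ depends only on $x$ and on $|X_{\mathcal D}|$, where $X_{\mathcal D}$ is the orthogonal projection of $X$ on $\mathcal D$; and that $(M,g,J)$ is QCH if it is QCH with respect to some such $\mathcal D$. A negative almost complex structure is a smooth orthogonal almost complex structure $\overline J$ on $(M,g)$ which at every point induces the orientation opposite to that of $J$. It satisfies the second Gray curvature condition $(G_2)$ if $$R(X,Y,Z,W)-R(\overline JX,\overline JY,Z,W)=R(\overline JX,Y,\overline JZ,W)+R(\overline JX,Y,Z,\overline JW)$$ for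 all tangent vectors $X,Y,Z,W$ at a common point. Then $(M,g,J)$ is QCH if and only if it admits a negative almost complex structure $\overline J$ satisfying $(G_2)$. Moreover, for every such $\overline J$, $(M,g,J)$ is QCH with respect to $\ker(J\overline J-\mathrm{Id})$ and with respect to $\ker(J\overline J+\mathrm{Id})$; and conversely every distribution $\mathcal D$ with respect to which $(M,g,J)$ is QCH is of the form $\ker(J\overline J-\mathrm{Id})$ for some negative almost complex structure $\overline J$ satisfying $(G_2)$, and also of the form $\ker(J\overline J+\mathrm{Id})$ for some such structure. -/

import Mathlib

open Bundle FiberBundle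
open scoped Manifold ContDiff

set_option linter.unusedSectionVars false
set_option linter.unusedSimpArgs false

noncomputable section

namespace KahlerSurface

section LeviCivita

variable {E : Type*} [NormedAddCommGroup E] [NormedSpace ℝ E] [FiniteDimensional ℝ E]
  {H : Type*} [TopologicalSpace H] {I : ModelWithCorners ℝ E H}
  {M : Type*} [TopologicalSpace M] [ChartedSpace H M] [IsManifold I ∞ M]
  [RiemannianBundle (fun x : M ↦ TangentSpace I x)]
  [IsContMDiffRiemannianBundle I ∞ E (fun x : M ↦ TangentSpace I x)]

/-- The function `x ↦ g(X, Y)`. -/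
def innerFun (X Y : Π x : M, TangentSpace I x) : M → ℝ := fun x ↦ inner ℝ (X x) (Y x)

theorem innerFun_comm (X Y : Π x : M, TangentSpace I x) : innerFun X Y = innerFun Y X := by
  ext y; exact real_inner_comm _ _

theorem mdiffAt_innerFun {X Y : Π x : M, TangentSpace I x} {x : M}
    (hX : MDiffAt (T% X) x) (hY : MDiffAt (T% Y) x) : MDiffAt (innerFun X Y) x :=
  MDifferentiableAt.inner_bundle (IB := I) (F := E) (E := fun x : M ↦ TangentSpace I x)
    (b := id) hX hY

theorem d_innerFun_smul_left {f : M → ℝ} {X Y : Π x : M, TangentSpace I x} {x : M}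
    (hf : MDiffAt f x) (hX : MDiffAt (T% X) x) (hY : MDiffAt (T% Y) x) (v : TangentSpace I x) :
    d% (innerFun (f • X) Y) x v =
      f x * d% (innerFun X Y) x v + inner ℝ (X x) (Y x) * d% f x v := by
  have h : innerFun (f • X) Y = f * innerFun X Y := by
    ext y; simp [innerFun, inner_smul_left]
  rw [h, mvfderiv_mul hf (mdiffAt_innerFun hX hY)]
  simp [innerFun]

theorem d_innerFun_add_left {X X' Y : Π x : M, TangentSpace I x} {x : M}
    (hX : MDiffAt (T% X) x) (hX' : MDiffAt (T% X') x) (hY : MDiffAt (T% Y) x)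
    (v : TangentSpace I x) :
    d% (innerFun (X + X') Y) x v = d% (innerFun X Y) x v + d% (innerFun X' Y) x v := by
  have h : innerFun (X + X') Y = innerFun X Y + innerFun X' Y := by
    ext y; simp [innerFun, inner_add_left]
  rw [h, mvfderiv_add (mdiffAt_innerFun hX hY) (mdiffAt_innerFun hX' hY)]
  simp

/-- Half of the right-hand side of the Koszul formula:
`½ (X g(Y,Z) + Y g(Z,X) - Z g(X,Y) + g([X,Y],Z) - g([X,Z],Y) - g([Y,Z],X))` at the point `x`. -/
def koszul (Y : Π x : M, TangentSpace I x) (x : M) (X Z : Π x : M, TangentSpace I x) : ℝ :=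
  2⁻¹ * (d% (innerFun Y Z) x (X x) + d% (innerFun Z X) x (Y x) - d% (innerFun X Y) x (Z x)
    + inner ℝ (VectorField.mlieBracket I X Y x) (Z x)
    - inner ℝ (VectorField.mlieBracket I X Z x) (Y x)
    - inner ℝ (VectorField.mlieBracket I Y Z x) (X x))

theorem koszul_tensorial_left {Y Z : Π x : M, TangentSpace I x} {x : M}
    (hY : MDiffAt (T% Y) x) (hZ : MDiffAt (T% Z) x) :
    TensorialAt I E (fun X ↦ koszul Y x X Z) x where
  smul {f X} hf hX := by
    simp only [koszul, innerFun_comm Z, d_innerFun_smul_left hf hX hZ,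
      d_innerFun_smul_left hf hX hY, VectorField.mlieBracket_smul_left hf hX, Pi.smul_apply',
      map_smul, inner_add_left, inner_smul_left, inner_smul_right, smul_eq_mul, neg_smul,
      inner_neg_left, RCLike.conj_to_real]
    ring
  add {X X'} hX hX' := by
    simp only [koszul, innerFun_comm Z, d_innerFun_add_left hX hX' hZ,
      d_innerFun_add_left hX hX' hY, VectorField.mlieBracket_add_left hX hX', Pi.add_apply,
      map_add, inner_add_left, inner_add_right]
    ring

theorem koszul_tensorial_right {Y X : Π x : M, TangentSpace I x} {x : M}
    (hY : MDiffAt (T% Y) x) (hX : MDiffAt (T% X) x) :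
    TensorialAt I E (koszul Y x X) x where
  smul {f Z} hf hZ := by
    simp only [koszul, innerFun_comm Y, d_innerFun_smul_left hf hZ hX,
      d_innerFun_smul_left hf hZ hY, VectorField.mlieBracket_smul_right hf hZ, Pi.smul_apply',
      map_smul, inner_add_left, inner_smul_left, inner_smul_right, smul_eq_mul,
      inner_add_right, RCLike.conj_to_real, real_inner_comm (X x), real_inner_comm (Y x)]
    ring
  add {Z Z'} hZ hZ' := by
    simp only [koszul, innerFun_comm Y, d_innerFun_add_left hZ hZ' hX,
      d_innerFun_add_left hZ hZ' hY, VectorField.mlieBracket_add_right hZ hZ', Pi.add_apply,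
      map_add, inner_add_left, inner_add_right]
    ring


/-- The Levi-Civita connection of the Riemannian metric, as a bare function: if the vector field `Y`
is differentiable at `x`, then `leviCivitaFun Y x u = ∇_u Y` is the tangent vector with
`g(∇_X Y, Z) = koszul Y x X Z` for all vector fields `X`, `Z` differentiable at `x`. -/
def leviCivitaFun (Y : Π x : M, TangentSpace I x) (x : M) :
    TangentSpace I x →L[ℝ] TangentSpace I x :=
  open Classical in
  have : FiniteDimensional ℝ (TangentSpace I x) := inferInstanceAs (FiniteDimensional ℝ E)
  have : CompleteSpace (TangentSpace I x) := FiniteDimensional.complete ℝ _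
  if hY : MDiffAt (T% Y) x then
    InnerProductSpace.continuousLinearMapOfBilin (𝕜 := ℝ)
      (TensorialAt.mkHom₂ (koszul Y x) x (fun _ hZ ↦ koszul_tensorial_left hY hZ)
        (fun _ hX ↦ koszul_tensorial_right hY hX))
  else 0

theorem inner_leviCivitaFun {X Y Z : Π x : M, TangentSpace I x} {x : M}
    (hX : MDiffAt (T% X) x) (hY : MDiffAt (T% Y) x) (hZ : MDiffAt (T% Z) x) :
    inner ℝ (leviCivitaFun Y x (X x)) (Z x) = koszul Y x X Z := by
  have : FiniteDimensional ℝ (TangentSpace I x) := inferInstanceAs (FiniteDimensional ℝ E)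
  have : CompleteSpace (TangentSpace I x) := FiniteDimensional.complete ℝ _
  rw [leviCivitaFun, dif_pos hY]
  refine (InnerProductSpace.continuousLinearMapOfBilin_apply (𝕜 := ℝ) _ _ _).trans ?_
  exact TensorialAt.mkHom₂_apply _ _ hX hZ

theorem koszul_add {X Y Y' Z : Π x : M, TangentSpace I x} {x : M}
    (hX : MDiffAt (T% X) x) (hY : MDiffAt (T% Y) x) (hY' : MDiffAt (T% Y') x)
    (hZ : MDiffAt (T% Z) x) :
    koszul (Y + Y') x X Z = koszul Y x X Z + koszul Y' x X Z := by
  simp only [koszul, innerFun_comm X, d_innerFun_add_left hY hY' hZ,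
    d_innerFun_add_left hY hY' hX, VectorField.mlieBracket_add_left hY hY',
    VectorField.mlieBracket_add_right hY hY', Pi.add_apply, map_add, inner_add_left,
    inner_add_right]
  ring

theorem koszul_smul {f : M → ℝ} {X Y Z : Π x : M, TangentSpace I x} {x : M}
    (hf : MDiffAt f x) (hX : MDiffAt (T% X) x) (hY : MDiffAt (T% Y) x) (hZ : MDiffAt (T% Z) x) :
    koszul (f • Y) x X Z = f x * koszul Y x X Z + d% f x (X x) * inner ℝ (Y x) (Z x) := by
  simp only [koszul, innerFun_comm X, d_innerFun_smul_left hf hY hZ,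
    d_innerFun_smul_left hf hY hX, VectorField.mlieBracket_smul_left hf hY,
    VectorField.mlieBracket_smul_right hf hY, Pi.smul_apply', map_smul, inner_add_left,
    inner_smul_left, inner_smul_right, smul_eq_mul, inner_neg_right, inner_add_right, neg_smul,
    inner_neg_left, RCLike.conj_to_real, real_inner_comm (X x)]
  ring

variable (I M) in
/-- The Levi-Civita connection of the Riemannian metric: `leviCivita I M Y x u = ∇_u Y`. -/
def leviCivita : CovariantDerivative I E (fun x : M ↦ TangentSpace I x) where
  toFun := leviCivitaFun
  isCovariantDerivativeOnUniv :=
    { add := fun {Y Y' x} hY hY' _ ↦ by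
        have hs : MDiffAt (T% (Y + Y')) x := mdifferentiableAt_add_section hY hY'
        ext1 u
        refine ext_inner_right ℝ fun w ↦ ?_
        have hu := mdifferentiableAt_extend I E u
        have hw := mdifferentiableAt_extend I E w
        have h1 := inner_leviCivitaFun hu hs hw
        have h2 := inner_leviCivitaFun hu hY hw
        have h3 := inner_leviCivitaFun hu hY' hw
        simp only [extend_apply_self] at h1 h2 h3
        rw [add_apply, inner_add_left, h1, h2, h3, koszul_add hu hY hY' hw]
      leibniz := fun {Y f x} hY hf _ ↦ by
        have hs : MDiffAt (T% (f • Y)) x := hf.smul_section hY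
        ext1 u
        refine ext_inner_right ℝ fun w ↦ ?_
        have hu := mdifferentiableAt_extend I E u
        have hw := mdifferentiableAt_extend I E w
        have h1 := inner_leviCivitaFun hu hs hw
        have h2 := inner_leviCivitaFun hu hY hw
        simp only [extend_apply_self] at h1 h2
        rw [h1, koszul_smul hf hu hY hw]
        simp [inner_add_left, inner_smul_left, h2] }

/-- The Levi-Civita connection is torsion-free. -/
theorem leviCivita_torsion : (leviCivita I M).torsion = 0 := by
  refine (leviCivita I M).torsion_eq_zero_iff.2 fun {X Y x} hX hY ↦ ?_
  refine ext_inner_right ℝ fun w ↦ ?_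
  have hw := mdifferentiableAt_extend I E w
  have h1 := inner_leviCivitaFun hX hY hw
  have h2 := inner_leviCivitaFun hY hX hw
  simp only [extend_apply_self] at h1 h2
  rw [inner_sub_left]
  refine (congrArg₂ (· - ·) h1 h2).trans ?_
  have h3 : VectorField.mlieBracket I Y X x = - VectorField.mlieBracket I X Y x :=
    VectorField.mlieBracket_swap_apply
  simp only [koszul, extend_apply_self, h3, innerFun_comm Y X, innerFun_comm X (extend E w),
    innerFun_comm Y (extend E w), inner_neg_left]
  ring

/-- The Levi-Civita connection is compatible with the metric. -/
theorem leviCivita_metric {X Y Z : Π x : M, TangentSpace I x} {x : M}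
    (hX : MDiffAt (T% X) x) (hY : MDiffAt (T% Y) x) (hZ : MDiffAt (T% Z) x) :
    d% (innerFun Y Z) x (X x) =
      inner ℝ (leviCivita I M Y x (X x)) (Z x) + inner ℝ (Y x) (leviCivita I M Z x (X x)) := by
  have h1 := inner_leviCivitaFun hX hY hZ
  have h2 := inner_leviCivitaFun hX hZ hY
  rw [real_inner_comm _ (Y x)]
  refine Eq.trans ?_ (congrArg₂ (· + ·) h1 h2).symm
  have h3 : VectorField.mlieBracket I Z Y x = - VectorField.mlieBracket I Y Z x :=
    VectorField.mlieBracket_swap_apply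
  simp only [koszul, h3, innerFun_comm Z Y, innerFun_comm X Z, innerFun_comm X Y, inner_neg_left]
  ring

/-- The curvature of the Levi-Civita connection on vector fields,
`R(X,Y)Z = ∇_X ∇_Y Z - ∇_Y ∇_X Z - ∇_[X,Y] Z`, at the point `x`. -/
def curvatureField (X Y Z : Π x : M, TangentSpace I x) (x : M) : TangentSpace I x :=
  leviCivita I M (fun y ↦ leviCivita I M Z y (Y y)) x (X x)
    - leviCivita I M (fun y ↦ leviCivita I M Z y (X y)) x (Y x)
    - leviCivita I M Z x (VectorField.mlieBracket I X Y x)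

/-- The curvature tensor `R(u,v,w,z) = g(R(u,v)w, z)` at the point `x`. The value of `R(X,Y)Z` at
`x` depends only on the values of the smooth vector fields `X`, `Y`, `Z` at `x`; we compute it with
the extensions of `u`, `v`, `w` that are constant in the preferred trivialization at `x`. -/
def riemann (x : M) (u v w z : TangentSpace I x) : ℝ :=
  inner ℝ (curvatureField (extend E u) (extend E v) (extend E w) x) z

end LeviCivita

section Surface

variable {M : Type*} [TopologicalSpace M] [ChartedSpace (EuclideanSpace ℝ (Fin 4)) M]
  [IsManifold (𝓡 4) ∞ M]
  [RiemannianBundle (fun x : M ↦ TangentSpace (𝓡 4) x)]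
  [IsContMDiffRiemannianBundle (𝓡 4) ∞ (EuclideanSpace ℝ (Fin 4))
    (fun x : M ↦ TangentSpace (𝓡 4) x)]

instance finiteDimensional_tangentSpace (x : M) : FiniteDimensional ℝ (TangentSpace (𝓡 4) x) :=
  inferInstanceAs (FiniteDimensional ℝ (EuclideanSpace ℝ (Fin 4)))

/-- A smooth almost complex structure `J` on a `4`-manifold, orthogonal for the metric. -/
structure IsAlmostHermitian (J : Π x : M, TangentSpace (𝓡 4) x →L[ℝ] TangentSpace (𝓡 4) x) :
    Prop where
  smooth : ContMDiff (𝓡 4)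
    ((𝓡 4).prod 𝓘(ℝ, EuclideanSpace ℝ (Fin 4) →L[ℝ] EuclideanSpace ℝ (Fin 4))) ∞
    (fun x ↦ TotalSpace.mk' (EuclideanSpace ℝ (Fin 4) →L[ℝ] EuclideanSpace ℝ (Fin 4))
      (E := fun x : M ↦ TangentSpace (𝓡 4) x →L[ℝ] TangentSpace (𝓡 4) x) x (J x))
  sq : ∀ (x : M) (u : TangentSpace (𝓡 4) x), J x (J x u) = -u
  orthogonal : ∀ (x : M) (u v : TangentSpace (𝓡 4) x),
    (inner ℝ (J x u) (J x v) : ℝ) = inner ℝ u v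

/-- `(M, g, J)` is a Kähler surface: `J` is an orthogonal almost complex structure which is
parallel for the Levi-Civita connection, i.e. `∇_u (J Y) = J (∇_u Y)`. -/
structure IsKahler (J : Π x : M, TangentSpace (𝓡 4) x →L[ℝ] TangentSpace (𝓡 4) x) : Prop
    extends IsAlmostHermitian J where
  parallel : ∀ (x : M) (Y : Π y : M, TangentSpace (𝓡 4) y),
    MDifferentiableAt (𝓡 4) (𝓡 4).tangent (T% Y) x →
    ∀ u : TangentSpace (𝓡 4) x,
      leviCivita (𝓡 4) M (fun y ↦ J y (Y y)) x u = J x (leviCivita (𝓡 4) M Y x u)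

/-- A basis of the form `(e, Je, f, Jf)`; all these bases induce the same orientation, which is the
orientation defined by `J`. -/
def IsAdaptedBasis {V : Type*} [AddCommGroup V] [Module ℝ V] (J : V → V)
    (b : Module.Basis (Fin 4) ℝ V) : Prop :=
  b 1 = J (b 0) ∧ b 3 = J (b 2)

/-- `J'` is a negative almost complex structure on `(M, g, J)`: it is smooth, orthogonal for the
metric, and at every point it induces the orientation opposite to the one induced by `J`. -/
structure IsNegativeAlmostComplex
    (J J' : Π x : M, TangentSpace (𝓡 4) x →L[ℝ] TangentSpace (𝓡 4) x) : Prop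
    extends IsAlmostHermitian J' where
  opposite : ∀ (x : M) (b b' : Module.Basis (Fin 4) ℝ (TangentSpace (𝓡 4) x)),
    IsAdaptedBasis (J x) b → IsAdaptedBasis (J' x) b' → b'.orientation = -b.orientation

/-- The second Gray curvature condition for `J`. -/
def SecondGrayCondition (J : Π x : M, TangentSpace (𝓡 4) x →L[ℝ] TangentSpace (𝓡 4) x) : Prop :=
  ∀ (x : M) (X Y Z W : TangentSpace (𝓡 4) x),
    riemann x X Y Z W - riemann x (J x X) (J x Y) Z W
      = riemann x (J x X) Y (J x Z) W + riemann x (J x X) Y Z (J x W)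

/-- A smooth `2`-dimensional distribution: each fibre is a plane, and near each point the fibres
are spanned by two smooth vector fields. -/
structure IsSmoothPlaneField (D : Π x : M, Submodule ℝ (TangentSpace (𝓡 4) x)) : Prop where
  finrank_eq : ∀ x, Module.finrank ℝ (D x) = 2
  smooth : ∀ x : M, ∃ U : Set M, IsOpen U ∧ x ∈ U ∧ ∃ X Y : Π y : M, TangentSpace (𝓡 4) y,
    ContMDiffOn (𝓡 4) (𝓡 4).tangent ∞ (T% X) U ∧ ContMDiffOn (𝓡 4) (𝓡 4).tangent ∞ (T% Y) U ∧
      ∀ y ∈ U, D y = Submodule.span ℝ {X y, Y y}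

/-- `(M, g, J)` is a QCH manifold with respect to the distribution `D`: `D` is smooth,
`2`-dimensional and `J`-invariant, and the holomorphic curvature `R(X,JX,JX,X)` of a unit vector `X`
depends only on its base point and on the norm of its orthogonal projection on `D`. -/
structure IsQCHWith (J : Π x : M, TangentSpace (𝓡 4) x →L[ℝ] TangentSpace (𝓡 4) x)
    (D : Π x : M, Submodule ℝ (TangentSpace (𝓡 4) x)) : Prop extends IsSmoothPlaneField D where
  invariant : ∀ (x : M), ∀ u ∈ D x, J x u ∈ D x
  curvature : ∀ (x : M) (X Y : TangentSpace (𝓡 4) x), ‖X‖ = 1 → ‖Y‖ = 1 →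
    ‖(D x).starProjection X‖ = ‖(D x).starProjection Y‖ →
      riemann x X (J x X) (J x X) X = riemann x Y (J x Y) (J x Y) Y

/-- The distribution `ker (J J' - Id)`. -/
def kerSub (J J' : Π x : M, TangentSpace (𝓡 4) x →L[ℝ] TangentSpace (𝓡 4) x) (x : M) :
    Submodule ℝ (TangentSpace (𝓡 4) x) :=
  LinearMap.ker ((J x).toLinearMap ∘ₗ (J' x).toLinearMap - LinearMap.id)

/-- The distribution `ker (J J' + Id)`. -/
def kerAdd (J J' : Π x : M, TangentSpace (𝓡 4) x →L[ℝ] TangentSpace (𝓡 4) x) (x : M) :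
    Submodule ℝ (TangentSpace (𝓡 4) x) :=
  LinearMap.ker ((J x).toLinearMap ∘ₗ (J' x).toLinearMap + LinearMap.id)

end Surface

end KahlerSurface

end

/-! Distributions and negative structures determine each other: `J'` equal to `-J` on `D` and to `J`
on the orthogonal complement satisfies `ker (J J' - Id) = D`. Conversely, two orthogonal complex
structures inducing opposite orientations in dimension four commute (`commute_of_opposite`). Hence
`J J'` is a symmetric involution, its eigenspaces are `J`-invariant, and neither is zero because
`J'` is not `±J`: both are planes (`finrank_eigenspace_eq_two`). Replacing `J'` by `-J'` exchanges
the two eigenspaces and preserves orientation and `(G_2)`, so `ker (J J' + Id)` needs no separate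
argument.

It remains to compare the two curvature conditions at one point. Parallelism of `J` makes the
curvature a symmetric bilinear form on `J`-invariant two-forms. In an orthonormal basis `e, Je` of
`D` and `f, Jf` of its complement, these are spanned by `formI`, `formII`, which are `J'`-invariant,
and `formIII`, `formIV`, on which `J'` acts by `-1`. Both QCH and `(G_2)` say that the mixed
coefficients vanish and that the form is a multiple of the identity on the span of `formIII` and
`formIV` (`gray_of_qch`, `qch_of_gray`).

The curvature symmetries needed for this are derived from the Koszul connection; the analytic input
is that covariant derivatives of smooth fields are smooth and that brackets act on functions as
commutators (`d_d_sub_d_d`). -/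

noncomputable section

namespace KahlerSurface

open Filter Topology InnerProductSpace

/-! ### Smooth fields near a point, and brackets acting on functions. -/

section Curvature

variable {E : Type*} [NormedAddCommGroup E] [NormedSpace ℝ E] [FiniteDimensional ℝ E]
  {H : Type*} [TopologicalSpace H] {I : ModelWithCorners ℝ E H}
  {M : Type*} [TopologicalSpace M] [ChartedSpace H M] [IsManifold I ∞ M]

theorem isManifold_minSmoothness (n : ℕ) : IsManifold I (minSmoothness ℝ n) M := by
  rw [minSmoothness_of_isRCLikeNormedField]
  exact IsManifold.of_le (n := ∞) (WithTop.coe_le_coe.2 le_top)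

/-- The vector field `X` is smooth in a neighbourhood of `x`. -/
def SmoothNear (X : Π y : M, TangentSpace I y) (x : M) : Prop :=
  ∀ᶠ y in 𝓝 x, ContMDiffAt I I.tangent ∞ (T% X) y

/-- The function `f` is smooth in a neighbourhood of `x`. -/
def SmoothFunNear (I : ModelWithCorners ℝ E H) (f : M → ℝ) (x : M) : Prop :=
  ∀ᶠ y in 𝓝 x, ContMDiffAt I 𝓘(ℝ, ℝ) ∞ f y

theorem SmoothNear.eventually {X : Π y : M, TangentSpace I y} {x : M} (h : SmoothNear X x) :
    ∀ᶠ y in 𝓝 x, SmoothNear X y :=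
  eventually_eventually_nhds.2 h

theorem SmoothFunNear.eventually {f : M → ℝ} {x : M} (h : SmoothFunNear I f x) :
    ∀ᶠ y in 𝓝 x, SmoothFunNear I f y :=
  eventually_eventually_nhds.2 h

theorem SmoothNear.mdiffAt {X : Π y : M, TangentSpace I y} {x : M} (h : SmoothNear X x) :
    MDiffAt (T% X) x :=
  h.self_of_nhds.mdifferentiableAt (by simp)

theorem SmoothFunNear.mdiffAt {f : M → ℝ} {x : M} (h : SmoothFunNear I f x) : MDiffAt f x :=
  ContMDiffAt.mdifferentiableAt (n := ∞) h.self_of_nhds (by simp)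

theorem SmoothNear.congr {X Y : Π y : M, TangentSpace I y} {x : M} (h : SmoothNear X x)
    (hXY : ∀ᶠ y in 𝓝 x, Y y = X y) : SmoothNear Y x := by
  filter_upwards [h, eventually_eventually_nhds.2 hXY] with y hy hy'
  exact hy.congr_of_eventuallyEq (hy'.mono fun z hz ↦ by simp [hz])

theorem smoothNear_extend {x : M} (v : TangentSpace I x) : SmoothNear (extend E v) x := by
  obtain ⟨s, hs, hsm⟩ := exists_contMDiffOn_extend (k := ∞) I E v
  filter_upwards [eventually_mem_nhds_iff.2 hs] with y hy
  exact hsm.contMDiffAt hy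

theorem SmoothNear.add {X Y : Π y : M, TangentSpace I y} {x : M} (hX : SmoothNear X x)
    (hY : SmoothNear Y x) : SmoothNear (X + Y) x := by
  filter_upwards [hX, hY] with y h1 h2 using h1.add_section h2

theorem SmoothNear.sub {X Y : Π y : M, TangentSpace I y} {x : M} (hX : SmoothNear X x)
    (hY : SmoothNear Y x) : SmoothNear (X - Y) x := by
  filter_upwards [hX, hY] with y h1 h2 using h1.sub_section h2

theorem SmoothNear.smul {f : M → ℝ} {Y : Π y : M, TangentSpace I y} {x : M}
    (hf : SmoothFunNear I f x) (hY : SmoothNear Y x) : SmoothNear (f • Y) x := by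
  filter_upwards [hf, hY] with y h1 h2 using h1.smul_section h2

theorem SmoothNear.mlieBracket {X Y : Π y : M, TangentSpace I y} {x : M} (hX : SmoothNear X x)
    (hY : SmoothNear Y x) : SmoothNear (VectorField.mlieBracket I X Y) x := by
  filter_upwards [hX, hY] with y h1 h2
  have h3 : IsManifold I (minSmoothness ℝ 2) M := isManifold_minSmoothness 2
  have h4 : IsManifold I (((⊤ : ℕ∞) : WithTop ℕ∞) + 1) M := inferInstanceAs (IsManifold I ∞ M)
  exact ContMDiffAt.mlieBracket_vectorField (m := ⊤) (n := ⊤) h1 h2 (by simp)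

theorem SmoothFunNear.d {f : M → ℝ} {X : Π y : M, TangentSpace I y} {x : M}
    (hf : SmoothFunNear I f x) (hX : SmoothNear X x) :
    SmoothFunNear I (fun y ↦ d% f y (X y)) x := by
  filter_upwards [hf, hX] with y h1 h2
  have h3 := ContMDiffAt.mfderiv_const (m := ∞) h1 (by simp)
  have h4 := ContMDiffAt.clm_apply_of_inCoordinates (b₁ := id) (b₂ := f) h3 h2 h1
  have h5 := (contMDiffAt_totalSpace.1 h4).2
  simp only [trivializationAt_model_space_apply] at h5
  exact h5

/-- The Lie bracket of vector fields acts on functions as the commutator of derivations. -/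
theorem d_d_sub_d_d {f : M → ℝ} {X Y : Π y : M, TangentSpace I y} {x : M}
    (hf : SmoothFunNear I f x) (hX : SmoothNear X x) (hY : SmoothNear Y x) :
    d% (fun y ↦ d% f y (Y y)) x (X x) - d% (fun y ↦ d% f y (X y)) x (Y x) =
      d% f x (VectorField.mlieBracket I X Y x) := by
  have h3 : IsManifold I (minSmoothness ℝ 3) M := isManifold_minSmoothness 3
  -- The identity is read off as the coefficient of a vector `Z x`, which must be nonzero; in a zero
  -- tangent space both sides vanish.
  by_cases hz : ∃ z : TangentSpace I x, z ≠ 0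
  swap
  · push Not at hz
    rw [hz (X x), hz (Y x), hz (VectorField.mlieBracket I X Y x)]
    simp
  obtain ⟨z, hz⟩ := hz
  set Z : Π y : M, TangentSpace I y := extend E z with hZdef
  have hZ : SmoothNear Z x := smoothNear_extend z
  have two {W : Π y : M, TangentSpace I y} (hW : SmoothNear W x) :
      ContMDiffAt I I.tangent (minSmoothness ℝ 2) (T% W) x := by
    rw [minSmoothness_of_isRCLikeNormedField]
    exact hW.self_of_nhds.of_le (WithTop.coe_le_coe.2 le_top)
  have key {V : Π y : M, TangentSpace I y} (hV : SmoothNear V x) :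
      ∀ᶠ y in 𝓝 x, VectorField.mlieBracket I V (f • Z) y =
        ((fun y ↦ d% f y (V y)) • Z + f • VectorField.mlieBracket I V Z) y := by
    filter_upwards [hf.eventually, hZ.eventually] with y h1 h2
    exact VectorField.mlieBracket_smul_right h1.mdiffAt h2.mdiffAt
  -- The Jacobi identity for `X, Y, f Z` minus `f` times the one for `X, Y, Z` leaves `(X Y f - Y X
  -- f - [X,Y] f) Z = 0`.
  have j1 := VectorField.leibniz_identity_mlieBracket_apply (two hX) (two hY)
    (two (hZ.smul hf))
  have j2 := VectorField.leibniz_identity_mlieBracket_apply (two hX) (two hY) (two hZ)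
  have hXY := hX.mlieBracket hY
  have e1 : VectorField.mlieBracket I X (VectorField.mlieBracket I Y (f • Z)) x =
      VectorField.mlieBracket I X
        ((fun y ↦ d% f y (Y y)) • Z + f • VectorField.mlieBracket I Y Z) x :=
    Filter.EventuallyEq.mlieBracket_vectorField_eq EventuallyEq.rfl (key hY)
  have e2 : VectorField.mlieBracket I Y (VectorField.mlieBracket I X (f • Z)) x =
      VectorField.mlieBracket I Y
        ((fun y ↦ d% f y (X y)) • Z + f • VectorField.mlieBracket I X Z) x :=
    Filter.EventuallyEq.mlieBracket_vectorField_eq EventuallyEq.rfl (key hX)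
  have ex {V W : Π y : M, TangentSpace I y} (hV : SmoothNear V x) (hW : SmoothNear W x) :
      VectorField.mlieBracket I W
        ((fun y ↦ d% f y (V y)) • Z + f • VectorField.mlieBracket I V Z) x =
      d% (fun y ↦ d% f y (V y)) x (W x) • Z x + d% f x (V x) • VectorField.mlieBracket I W Z x +
       (d% f x (W x) • VectorField.mlieBracket I V Z x +
        f x • VectorField.mlieBracket I W (VectorField.mlieBracket I V Z) x) := by
    have a1 := (hZ.smul (hf.d hV)).mdiffAt
    have a2 := ((hV.mlieBracket hZ).smul hf).mdiffAt
    rw [VectorField.mlieBracket_add_right a1 a2,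
      VectorField.mlieBracket_smul_right (hf.d hV).mdiffAt hZ.mdiffAt,
      VectorField.mlieBracket_smul_right hf.mdiffAt (hV.mlieBracket hZ).mdiffAt]
  rw [e1, e2, ex hY hX, ex hX hY, (key hXY).self_of_nhds, j2] at j1
  simp only [Pi.add_apply, Pi.smul_apply', smul_add] at j1
  have hZx : Z x ≠ 0 := by simpa [hZdef] using hz
  have j3 : (d% (fun y ↦ d% f y (Y y)) x (X x) - d% (fun y ↦ d% f y (X y)) x (Y x) -
      d% f x (VectorField.mlieBracket I X Y x)) • Z x = 0 := by
    rw [← sub_eq_zero] at j1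
    rw [sub_smul, sub_smul, ← j1]
    abel
  exact sub_eq_zero.1 ((smul_eq_zero.1 j3).resolve_right hZx)

end Curvature

/-! ### Smoothness of the Levi-Civita connection and symmetries of its curvature. -/

section CurvatureTensor

variable {E : Type*} [NormedAddCommGroup E] [NormedSpace ℝ E] [FiniteDimensional ℝ E]
  {H : Type*} [TopologicalSpace H] {I : ModelWithCorners ℝ E H}
  {M : Type*} [TopologicalSpace M] [ChartedSpace H M] [IsManifold I ∞ M]
  [RiemannianBundle (fun x : M ↦ TangentSpace I x)]
  [IsContMDiffRiemannianBundle I ∞ E (fun x : M ↦ TangentSpace I x)]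

theorem SmoothNear.innerFun {X Y : Π y : M, TangentSpace I y} {x : M}
    (hX : SmoothNear X x) (hY : SmoothNear Y x) : SmoothFunNear I (innerFun X Y) x := by
  filter_upwards [hX, hY] with y h1 h2
  exact ContMDiffAt.inner_bundle (IB := I) (F := E) (E := fun x : M ↦ TangentSpace I x)
    (b := id) h1 h2

theorem SmoothFunNear.add {f g : M → ℝ} {x : M} (hf : SmoothFunNear I f x)
    (hg : SmoothFunNear I g x) : SmoothFunNear I (fun y ↦ f y + g y) x := by
  filter_upwards [hf, hg] with y h1 h2 using ContMDiffAt.add h1 h2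

theorem SmoothFunNear.sub {f g : M → ℝ} {x : M} (hf : SmoothFunNear I f x)
    (hg : SmoothFunNear I g x) : SmoothFunNear I (fun y ↦ f y - g y) x := by
  filter_upwards [hf, hg] with y h1 h2 using ContMDiffAt.sub h1 h2

theorem SmoothFunNear.const_mul (c : ℝ) {f : M → ℝ} {x : M} (hf : SmoothFunNear I f x) :
    SmoothFunNear I (fun y ↦ c * f y) x := by
  filter_upwards [hf] with y h1 using contMDiffAt_const.mul h1

theorem SmoothFunNear.div {f g : M → ℝ} {x : M} (hf : SmoothFunNear I f x)
    (hg : SmoothFunNear I g x) (h0 : g x ≠ 0) : SmoothFunNear I (fun y ↦ f y / g y) x := by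
  have h0' : ∀ᶠ y in 𝓝 x, g y ≠ 0 :=
    (ContMDiffAt.continuousAt hg.self_of_nhds).eventually_ne h0
  filter_upwards [hf, hg, h0'] with y h1 h2 h3 using h1.div₀ h2 h3

theorem SmoothNear.sum {ι : Type*} {s : Finset ι} {X : ι → Π y : M, TangentSpace I y} {x : M}
    (h : ∀ i ∈ s, SmoothNear (X i) x) : SmoothNear (fun y ↦ ∑ i ∈ s, X i y) x := by
  filter_upwards [(Filter.eventually_all_finset s).2 h] with y hy
  exact ContMDiffAt.sum_section hy

theorem smoothFunNear_koszul {X Y Z : Π y : M, TangentSpace I y} {x : M}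
    (hX : SmoothNear X x) (hY : SmoothNear Y x) (hZ : SmoothNear Z x) :
    SmoothFunNear I (fun y ↦ koszul Y y X Z) x :=
  SmoothFunNear.const_mul _ (((((((hY.innerFun hZ).d hX).add ((hZ.innerFun hX).d hY)).sub
    ((hX.innerFun hY).d hZ)).add ((hX.mlieBracket hY).innerFun hZ)).sub
    ((hX.mlieBracket hZ).innerFun hY)).sub ((hY.mlieBracket hZ).innerFun hX))

/-- Near each point there is a smooth orthogonal frame of the tangent bundle. -/
theorem exists_orthogonal_frame (x : M) :
    ∃ e : Fin (Module.finrank ℝ E) → Π y : M, TangentSpace I y,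
      (∀ i, SmoothNear (e i) x) ∧ ∀ᶠ y in 𝓝 x, (∀ i, e i y ≠ 0) ∧
        ∀ v : TangentSpace I y,
          v = ∑ i, ((inner ℝ v (e i y) : ℝ) / inner ℝ (e i y) (e i y)) • e i y := by
  set t := trivializationAt E (TangentSpace I : M → Type _) x
  have hx : t.baseSet ∈ 𝓝 x :=
    t.open_baseSet.mem_nhds (FiberBundle.mem_baseSet_trivializationAt' x)
  set b := Module.finBasis ℝ E
  set s := t.localFrame b
  have hs : IsLocalFrameOn I E ∞ s t.baseSet := t.isLocalFrameOn_localFrame_baseSet I ∞ b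
  have hsm (i) : SmoothNear (s i) x := by
    filter_upwards [eventually_mem_nhds_iff.2 hx] with y hy
    exact (hs.contMDiffOn i).contMDiffAt hy
  -- Gram–Schmidt without normalization: only divisions by nonvanishing smooth functions occur, so
  -- smoothness follows by induction on the index.
  set e : Fin (Module.finrank ℝ E) → Π y : M, TangentSpace I y :=
    fun i y ↦ gramSchmidt ℝ (fun j ↦ s j y) i
  have hli (y) (hy : y ∈ t.baseSet) : LinearIndependent ℝ (fun j ↦ s j y) :=
    hs.linearIndependent hy
  have hne (y) (hy : y ∈ t.baseSet) (i) : e i y ≠ 0 := gramSchmidt_ne_zero i (hli y hy)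
  refine ⟨e, fun i ↦ ?_, ?_⟩
  · induction i using WellFoundedLT.induction with
    | ind i ih =>
      have h1 : SmoothNear (s i - fun y ↦ ∑ j ∈ Finset.Iio i,
          ((fun y ↦ innerFun (e j) (s i) y / innerFun (e j) (e j) y) • e j) y) x := by
        refine (hsm i).sub (SmoothNear.sum fun j hj ↦ ?_)
        have hj' := ih j (Finset.mem_Iio.1 hj)
        refine SmoothNear.smul ((hj'.innerFun (hsm i)).div (hj'.innerFun hj') ?_) hj'
        exact inner_self_ne_zero.2 (hne x (mem_of_mem_nhds hx) j)
      refine h1.congr (Eventually.of_forall fun y ↦ ?_)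
      simp only [e, Pi.sub_apply, Pi.smul_apply', innerFun]
      rw [gramSchmidt_def]
      congr 1
      refine Finset.sum_congr rfl fun j _ ↦ ?_
      rw [Submodule.starProjection_singleton, real_inner_self_eq_norm_sq]
      simp
  · filter_upwards [hx] with y hy
    refine ⟨hne y hy, fun v ↦ ?_⟩
    have horth : ∀ i j, i ≠ j → (inner ℝ (e i y) (e j y) : ℝ) = 0 :=
      fun i j hij ↦ gramSchmidt_orthogonal ℝ _ hij
    have hspan : Submodule.span ℝ (Set.range fun i ↦ e i y) = ⊤ := by
      rw [span_gramSchmidt]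
      exact top_le_iff.1 (hs.generating hy)
    have hv : v ∈ Submodule.span ℝ (Set.range fun i ↦ e i y) := hspan ▸ Submodule.mem_top
    obtain ⟨c, rfl⟩ := (Submodule.mem_span_range_iff_exists_fun ℝ).1 hv
    refine Finset.sum_congr rfl fun i _ ↦ ?_
    congr 1
    rw [sum_inner, Finset.sum_eq_single i]
    · rw [real_inner_smul_left, mul_div_cancel_right₀ _ (inner_self_ne_zero.2 (hne y hy i))]
    · intro j _ hj
      rw [real_inner_smul_left, horth j i hj, mul_zero]
    · simp

/-- The covariant derivative of a smooth vector field along a smooth vector field is smooth. -/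
theorem SmoothNear.leviCivita {X Y : Π y : M, TangentSpace I y} {x : M}
    (hX : SmoothNear X x) (hY : SmoothNear Y x) :
    SmoothNear (fun y ↦ leviCivita I M Y y (X y)) x := by
  obtain ⟨e, he, hv⟩ := exists_orthogonal_frame (I := I) x
  -- In an orthogonal frame the coefficients of `∇_X Y` are Koszul expressions divided by squared
  -- norms.
  have h1 : SmoothNear (fun y ↦ ∑ i, ((fun y ↦ koszul Y y X (e i) /
      KahlerSurface.innerFun (e i) (e i) y) • e i) y) x := by
    refine SmoothNear.sum fun i _ ↦ SmoothNear.smul ?_ (he i)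
    exact (smoothFunNear_koszul hX hY (he i)).div ((he i).innerFun (he i))
      (inner_self_ne_zero.2 (hv.self_of_nhds.1 i))
  refine h1.congr ?_
  filter_upwards [hv, hX.eventually, hY.eventually,
    eventually_all.2 fun i ↦ (he i).eventually] with y h2 h3 h4 h5
  rw [h2.2 (KahlerSurface.leviCivita I M Y y (X y))]
  refine Finset.sum_congr rfl fun i _ ↦ ?_
  simp only [Pi.smul_apply', KahlerSurface.innerFun]
  rw [← inner_leviCivitaFun h3.mdiffAt h4.mdiffAt (h5 i).mdiffAt]
  rfl

theorem mvfderiv_congr {f g : M → ℝ} {x : M} (h : f =ᶠ[𝓝 x] g) : d% f x = d% g x := by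
  have h1 : mfderiv I 𝓘(ℝ, ℝ) f x = mfderiv I 𝓘(ℝ, ℝ) g x := h.mfderiv_eq
  ext v
  exact DFunLike.congr_fun h1 v

theorem curvatureField_swap (X Y Z : Π y : M, TangentSpace I y) (x : M) :
    curvatureField X Y Z x = - curvatureField Y X Z x := by
  simp only [curvatureField]
  rw [VectorField.mlieBracket_swap_apply, map_neg]
  abel

theorem d_d_innerFun {X Y Z W : Π y : M, TangentSpace I y} {x : M} (hX : SmoothNear X x)
    (hY : SmoothNear Y x) (hZ : SmoothNear Z x) (hW : SmoothNear W x) :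
    d% (fun y ↦ d% (innerFun Z W) y (Y y)) x (X x) =
      inner ℝ (leviCivita I M (fun y ↦ leviCivita I M Z y (Y y)) x (X x)) (W x) +
      inner ℝ (leviCivita I M Z x (Y x)) (leviCivita I M W x (X x)) +
      (inner ℝ (leviCivita I M Z x (X x)) (leviCivita I M W x (Y x)) +
      inner ℝ (Z x) (leviCivita I M (fun y ↦ leviCivita I M W y (Y y)) x (X x))) := by
  have h1 : (fun y ↦ d% (innerFun Z W) y (Y y)) =ᶠ[𝓝 x]
      (innerFun (fun y ↦ leviCivita I M Z y (Y y)) W +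
        innerFun Z (fun y ↦ leviCivita I M W y (Y y))) := by
    filter_upwards [hY.eventually, hZ.eventually, hW.eventually] with y h1 h2 h3
    exact leviCivita_metric h1.mdiffAt h2.mdiffAt h3.mdiffAt
  have hYZ := hY.leviCivita hZ
  have hYW := hY.leviCivita hW
  rw [mvfderiv_congr h1, mvfderiv_add (hYZ.innerFun hW).mdiffAt (hZ.innerFun hYW).mdiffAt,
    add_apply, leviCivita_metric hX.mdiffAt hYZ.mdiffAt hW.mdiffAt,
    leviCivita_metric hX.mdiffAt hZ.mdiffAt hYW.mdiffAt]

/-- Expand `X Y g(Z,W) - Y X g(Z,W) = [X,Y] g(Z,W)` by metric compatibility; the terms with one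
derivative on each factor cancel. -/
theorem inner_curvatureField_self {X Y Z W : Π y : M, TangentSpace I y} {x : M}
    (hX : SmoothNear X x) (hY : SmoothNear Y x) (hZ : SmoothNear Z x) (hW : SmoothNear W x) :
    (inner ℝ (curvatureField X Y Z x) (W x) : ℝ) = - inner ℝ (Z x) (curvatureField X Y W x) := by
  have h1 := d_d_sub_d_d (hZ.innerFun hW) hX hY
  rw [d_d_innerFun hX hY hZ hW, d_d_innerFun hY hX hZ hW,
    leviCivita_metric (hX.mlieBracket hY).mdiffAt hZ.mdiffAt hW.mdiffAt] at h1
  simp only [curvatureField, inner_sub_left, inner_sub_right]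
  linear_combination h1

/-- Tensoriality in the third argument comes free from skew-adjointness, which moves the curvature
onto the test field and leaves only the value of `Z` at `x`. -/
theorem curvatureField_congr {X Y Z Z' : Π y : M, TangentSpace I y} {x : M}
    (hX : SmoothNear X x) (hY : SmoothNear Y x) (hZ : SmoothNear Z x) (hZ' : SmoothNear Z' x)
    (h : Z x = Z' x) : curvatureField X Y Z x = curvatureField X Y Z' x := by
  refine ext_inner_right ℝ fun w ↦ ?_
  have hw := smoothNear_extend w
  have h1 := inner_curvatureField_self hX hY hZ hw
  have h2 := inner_curvatureField_self hX hY hZ' hw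
  rw [h, ← h2, extend_apply_self] at h1
  exact h1

theorem leviCivita_sub_leviCivita {X Y : Π y : M, TangentSpace I y} {x : M}
    (hX : MDiffAt (T% X) x) (hY : MDiffAt (T% Y) x) :
    leviCivita I M Y x (X x) - leviCivita I M X x (Y x) = VectorField.mlieBracket I X Y x :=
  (leviCivita I M).torsion_eq_zero_iff.1 leviCivita_torsion hX hY

theorem leviCivita_congr {Y Y' : Π y : M, TangentSpace I y} {x : M}
    (hY : SmoothNear Y x) (h : Y =ᶠ[𝓝 x] Y') :
    leviCivita I M Y x = leviCivita I M Y' x := by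
  have hY' : SmoothNear Y' x := hY.congr h.symm
  exact (leviCivita I M).isCovariantDerivativeOnUniv.congr_of_eventuallyEq
    hY.mdiffAt hY'.mdiffAt univ_mem h

theorem leviCivita_sub {Y Y' : Π y : M, TangentSpace I y} {x : M}
    (hY : SmoothNear Y x) (hY' : SmoothNear Y' x) :
    leviCivita I M (Y - Y') x = leviCivita I M Y x - leviCivita I M Y' x := by
  have h := (leviCivita I M).isCovariantDerivativeOnUniv.add (hY.sub hY').mdiffAt hY'.mdiffAt
  rw [sub_add_cancel] at h
  exact eq_sub_of_add_eq h.symm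

/-- The algebraic Bianchi identity. -/
theorem curvatureField_bianchi {X Y Z : Π y : M, TangentSpace I y} {x : M}
    (hX : SmoothNear X x) (hY : SmoothNear Y x) (hZ : SmoothNear Z x) :
    curvatureField X Y Z x + curvatureField Y Z X x + curvatureField Z X Y x = 0 := by
  -- Vanishing torsion, used twice: `∇_X (∇_Y Z - ∇_Z Y) = ∇_X [Y,Z] = ∇_[Y,Z] X + [X,[Y,Z]]`. In
  -- the cyclic sum only the Jacobi expression survives.
  have key {X Y Z : Π y : M, TangentSpace I y}
      (hX : SmoothNear X x) (hY : SmoothNear Y x) (hZ : SmoothNear Z x) :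
      leviCivita I M (fun y ↦ leviCivita I M Z y (Y y)) x (X x)
        - leviCivita I M (fun y ↦ leviCivita I M Y y (Z y)) x (X x) =
      leviCivita I M X x (VectorField.mlieBracket I Y Z x)
        + VectorField.mlieBracket I X (VectorField.mlieBracket I Y Z) x := by
    have h1 := hY.leviCivita hZ
    have h2 := hZ.leviCivita hY
    have h3 : ((fun y ↦ leviCivita I M Z y (Y y)) - fun y ↦ leviCivita I M Y y (Z y))
        =ᶠ[𝓝 x] VectorField.mlieBracket I Y Z := by
      filter_upwards [hY.eventually, hZ.eventually] with y h3 h4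
      exact leviCivita_sub_leviCivita h3.mdiffAt h4.mdiffAt
    rw [← leviCivita_sub_leviCivita hX.mdiffAt (hY.mlieBracket hZ).mdiffAt,
      ← leviCivita_congr (h1.sub h2) h3, leviCivita_sub h1 h2]
    simp
  have h3 : IsManifold I (minSmoothness ℝ 3) M := isManifold_minSmoothness 3
  have two {W : Π y : M, TangentSpace I y} (hW : SmoothNear W x) :
      ContMDiffAt I I.tangent (minSmoothness ℝ 2) (T% W) x := by
    rw [minSmoothness_of_isRCLikeNormedField]
    exact hW.self_of_nhds.of_le (WithTop.coe_le_coe.2 le_top)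
  have jac := VectorField.leibniz_identity_mlieBracket_apply (two hX) (two hY) (two hZ)
  have s1 : VectorField.mlieBracket I (VectorField.mlieBracket I X Y) Z x =
      - VectorField.mlieBracket I Z (VectorField.mlieBracket I X Y) x :=
    VectorField.mlieBracket_swap_apply
  have s2 : VectorField.mlieBracket I Y (VectorField.mlieBracket I X Z) x =
      - VectorField.mlieBracket I Y (VectorField.mlieBracket I Z X) x := by
    rw [VectorField.mlieBracket_swap (V := X) (W := Z)]
    have := VectorField.mlieBracket_const_smul_right (I := I) (V := Y) (c := (-1 : ℝ))
      (hZ.mlieBracket hX).mdiffAt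
    simpa using this
  rw [s1, s2] at jac
  have k1 := key hX hY hZ
  have k2 := key hY hZ hX
  have k3 := key hZ hX hY
  have jac' := sub_eq_zero.2 jac
  simp only [curvatureField]
  rw [← sub_eq_zero] at k1 k2 k3
  rw [← add_zero (0 : TangentSpace I x)]
  calc _ = _ := ?_
    _ = _ := congrArg₂ (· + ·) (congrArg₂ (· + ·) (congrArg₂ (· + ·) k1 k2) k3) jac'
    _ = _ := by simp
  abel

theorem riemann_swap_left (x : M) (u v w z : TangentSpace I x) :
    riemann x u v w z = - riemann x v u w z := by
  simp only [riemann]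
  rw [curvatureField_swap, inner_neg_left]

theorem riemann_swap_right (x : M) (u v w z : TangentSpace I x) :
    riemann x u v w z = - riemann x u v z w := by
  have h := inner_curvatureField_self (smoothNear_extend u) (smoothNear_extend v)
    (smoothNear_extend w) (smoothNear_extend z)
  rw [extend_apply_self, extend_apply_self, real_inner_comm _ w] at h
  exact h

theorem riemann_bianchi (x : M) (u v w z : TangentSpace I x) :
    riemann x u v w z + riemann x v w u z + riemann x w u v z = 0 := by
  simp only [riemann]
  rw [← inner_add_left, ← inner_add_left, curvatureField_bianchi (smoothNear_extend u)
    (smoothNear_extend v) (smoothNear_extend w), inner_zero_left]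

end CurvatureTensor

/-! ### Orthogonal complex structures on a four-dimensional space. -/

section Algebra

variable {V : Type*} [NormedAddCommGroup V] [InnerProductSpace ℝ V]

/-- An orthogonal complex structure on an inner product space. -/
structure IsOrthogonalComplex (J : V →ₗ[ℝ] V) : Prop where
  sq : ∀ u, J (J u) = -u
  orthogonal : ∀ u v, (inner ℝ (J u) (J v) : ℝ) = inner ℝ u v

namespace IsOrthogonalComplex

variable {J J' : V →ₗ[ℝ] V}

theorem inner_left (hJ : IsOrthogonalComplex J) (u v : V) :
    (inner ℝ (J u) v : ℝ) = - inner ℝ u (J v) := by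
  rw [← hJ.orthogonal u, hJ.sq, inner_neg_right, neg_neg]

theorem inner_self (hJ : IsOrthogonalComplex J) (u : V) : (inner ℝ (J u) u : ℝ) = 0 := by
  have h := hJ.inner_left u u
  rw [real_inner_comm] at h
  linarith [real_inner_comm u (J u)]

theorem norm_map (hJ : IsOrthogonalComplex J) (u : V) : ‖J u‖ = ‖u‖ := by
  rw [norm_eq_sqrt_real_inner, hJ.orthogonal, ← norm_eq_sqrt_real_inner]

variable [FiniteDimensional ℝ V]

theorem exists_orthonormalBasis (hJ : IsOrthogonalComplex J) (hV : Module.finrank ℝ V = 4)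
    {e f : V} (he : ‖e‖ = 1) (hf : ‖f‖ = 1) (hef : (inner ℝ e f : ℝ) = 0)
    (hJef : (inner ℝ (J e) f : ℝ) = 0) :
    ∃ b : OrthonormalBasis (Fin 4) ℝ V, b 0 = e ∧ b 1 = J e ∧ b 2 = f ∧ b 3 = J f := by
  have h1 : (inner ℝ e (J f) : ℝ) = 0 := by
    have := hJ.inner_left e f
    linarith
  have he' : (inner ℝ e (J e) : ℝ) = 0 := by rw [real_inner_comm]; exact hJ.inner_self e
  have hf' : (inner ℝ f (J f) : ℝ) = 0 := by rw [real_inner_comm]; exact hJ.inner_self f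
  have ho : Orthonormal ℝ ![e, J e, f, J f] := by
    constructor
    · intro i
      fin_cases i <;> simp [hJ.norm_map, he, hf]
    · intro i j hij
      fin_cases i <;> fin_cases j <;>
        first
        | exact absurd rfl hij
        | simp [hef, hJef, h1, he', hf', hJ.orthogonal, hJ.inner_self,
            real_inner_comm e f, real_inner_comm (J e) f, real_inner_comm e (J f),
            real_inner_comm (J e) (J f)]
  have hc : Fintype.card (Fin 4) = Module.finrank ℝ V := by simp [hV]
  refine ⟨(basisOfOrthonormalOfCardEqFinrank ho hc).toOrthonormalBasis (by simpa using ho), ?_⟩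
  simp

theorem exists_unit_mem {D : Submodule ℝ V} (hD : D ≠ ⊥) : ∃ e ∈ D, ‖e‖ = 1 := by
  obtain ⟨v, hv, h0⟩ := D.exists_mem_ne_zero_of_ne_bot hD
  exact ⟨(‖v‖⁻¹ : ℝ) • v, D.smul_mem _ hv, norm_smul_inv_norm (𝕜 := ℝ) h0⟩

theorem exists_adapted_orthonormalBasis (hJ : IsOrthogonalComplex J)
    (hV : Module.finrank ℝ V = 4) {D : Submodule ℝ V} (hD : Module.finrank ℝ D = 2)
    (hinv : ∀ u ∈ D, J u ∈ D) :
    ∃ b : OrthonormalBasis (Fin 4) ℝ V, b 1 = J (b 0) ∧ b 3 = J (b 2) ∧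
      b 0 ∈ D ∧ b 1 ∈ D ∧ b 2 ∈ Dᗮ ∧ b 3 ∈ Dᗮ := by
  have hD' : Module.finrank ℝ Dᗮ = 2 := by
    have := D.finrank_add_finrank_orthogonal
    omega
  obtain ⟨e, heD, he⟩ := exists_unit_mem (D := D) (by rintro rfl; simp at hD)
  obtain ⟨f, hfD, hf⟩ := exists_unit_mem (D := Dᗮ) (by
    intro h
    rw [h] at hD'
    simp at hD')
  obtain ⟨b, h0, h1, h2, h3⟩ := hJ.exists_orthonormalBasis hV he hf (hfD e heD)
    (hfD _ (hinv e heD))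
  refine ⟨b, by rw [h1, h0], by rw [h3, h2], h0 ▸ heD, h1 ▸ hinv e heD, h2 ▸ hfD, ?_⟩
  rw [h3]
  intro u hu
  have := hJ.inner_left u f
  have h4 : (inner ℝ (J u) f : ℝ) = 0 := hfD _ (hinv u hu)
  linarith

/-- On an invariant line `J e` would be a multiple of `e`, yet it is orthogonal to `e` and has the
same norm. -/
theorem finrank_ne_one (hJ : IsOrthogonalComplex J) {D : Submodule ℝ V}
    (hinv : ∀ u ∈ D, J u ∈ D) : Module.finrank ℝ D ≠ 1 := by
  intro h
  obtain ⟨e, heD, he⟩ := exists_unit_mem (D := D) (by rintro rfl; simp at h)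
  have he0 : e ≠ 0 := by rintro rfl; simp at he
  obtain ⟨c, hc⟩ := (finrank_eq_one_iff_of_nonzero' (⟨e, heD⟩ : D)
    (by simpa using he0)).1 h ⟨J e, hinv e heD⟩
  have hc' : c • e = J e := congrArg Subtype.val hc
  have h1 := hJ.inner_self e
  rw [← hc', real_inner_smul_left, real_inner_self_eq_norm_sq, he] at h1
  have h2 := hJ.norm_map e
  have h3 : c = 0 := by linarith
  rw [← hc', h3, he] at h2
  simp at h2

theorem exists_orthonormalBasis_first (hJ : IsOrthogonalComplex J)
    (hV : Module.finrank ℝ V = 4) :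
    ∃ b : OrthonormalBasis (Fin 4) ℝ V, b 1 = J (b 0) ∧ b 3 = J (b 2) := by
  obtain ⟨e, -, he⟩ := exists_unit_mem (D := (⊤ : Submodule ℝ V)) (by
    intro h
    have := finrank_top ℝ V
    rw [h] at this
    simp [hV] at this)
  set D := Submodule.span ℝ {e, J e}
  have hle : Module.finrank ℝ D ≤ 2 := by
    classical
    have h := finrank_span_finset_le_card (R := ℝ) ({e, J e} : Finset V)
    rw [Finset.coe_pair] at h
    exact h.trans Finset.card_le_two
  obtain ⟨f, hfD, hf⟩ := exists_unit_mem (D := Dᗮ) (by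
    intro h
    have h1 := D.finrank_add_finrank_orthogonal
    rw [h] at h1
    simp at h1
    omega)
  obtain ⟨b, h0, h1, h2, h3⟩ := hJ.exists_orthonormalBasis hV he hf
    (hfD e (Submodule.subset_span (by simp))) (hfD _ (Submodule.subset_span (by simp)))
  exact ⟨b, by rw [h1, h0], by rw [h3, h2]⟩

end IsOrthogonalComplex

/-! ### Orientations induced by complex structures. -/

section Orientation

variable {W : Type*} [AddCommGroup W] [Module ℝ W]

theorem basis_det_fin_four (b : Module.Basis (Fin 4) ℝ W) (v : Fin 4 → W) :
    b.det v = (Matrix.of fun i j ↦ b.repr (v j) i).det := rfl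

theorem IsAdaptedBasis.apply {J : W →ₗ[ℝ] W} (hJ : ∀ u, J (J u) = -u)
    {b : Module.Basis (Fin 4) ℝ W} (hb : IsAdaptedBasis J b) (x : W) :
    J x = (-b.repr x 1) • b 0 + b.repr x 0 • b 1 + (-b.repr x 3) • b 2 + b.repr x 2 • b 3 := by
  have h1 : J (b 1) = - b 0 := by rw [hb.1, hJ]
  have h3 : J (b 3) = - b 2 := by rw [hb.2, hJ]
  conv_lhs => rw [← b.sum_repr x]
  simp only [Fin.sum_univ_four, map_add, map_smul, ← hb.1, ← hb.2, h1, h3]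
  module

/-- All adapted bases of a complex structure induce the same orientation. -/
theorem IsAdaptedBasis.orientation_eq {J : W →ₗ[ℝ] W} (hJ : ∀ u, J (J u) = -u)
    {b b' : Module.Basis (Fin 4) ℝ W} (hb : IsAdaptedBasis J b) (hb' : IsAdaptedBasis J b') :
    b.orientation = b'.orientation := by
  rw [Module.Basis.orientation_eq_iff_det_pos]
  have hne : b.det b' ≠ 0 := (b.isUnit_det b').ne_zero
  -- The real determinant of a complex-linear map is the squared modulus of its complex determinant;
  -- the two squares are the real and imaginary parts of a complex `2 × 2` determinant.
  have key : b.det b' =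
      (b.repr (b' 0) 0 * b.repr (b' 2) 2 - b.repr (b' 0) 1 * b.repr (b' 2) 3
        - b.repr (b' 0) 2 * b.repr (b' 2) 0 + b.repr (b' 0) 3 * b.repr (b' 2) 1) ^ 2 +
      (b.repr (b' 0) 0 * b.repr (b' 2) 3 + b.repr (b' 0) 1 * b.repr (b' 2) 2
        - b.repr (b' 0) 2 * b.repr (b' 2) 1 - b.repr (b' 0) 3 * b.repr (b' 2) 0) ^ 2 := by
    rw [basis_det_fin_four]
    simp only [Matrix.det_succ_row_zero, Fin.sum_univ_succ]
    simp [Matrix.of_apply, Fin.succAbove, hb'.1, hb'.2, hb.apply hJ, Finsupp.single_apply]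
    ring
  rw [key] at hne ⊢
  positivity

theorem exists_basis_of_det_ne_zero (b : Module.Basis (Fin 4) ℝ W) {v : Fin 4 → W}
    (h : b.det v ≠ 0) : ∃ b' : Module.Basis (Fin 4) ℝ W, ⇑b' = v := by
  obtain ⟨h1, h2⟩ := (Module.Basis.is_basis_iff_det b).2 (isUnit_iff_ne_zero.2 h)
  exact ⟨Module.Basis.mk h1 h2.ge, Module.Basis.coe_mk h1 h2.ge⟩

/-- Reversing `J` on one of two invariant planes changes the sign of a single vector of an adapted
basis. -/
theorem opposite_of_flip {J J' : W →ₗ[ℝ] W} (hJ : ∀ u, J (J u) = -u) (hJ' : ∀ u, J' (J' u) = -u)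
    {b : Module.Basis (Fin 4) ℝ W} (hb : IsAdaptedBasis J b)
    (h0 : J' (b 0) = -b 1) (h2 : J' (b 2) = b 3)
    {c c' : Module.Basis (Fin 4) ℝ W} (hc : IsAdaptedBasis J c) (hc' : IsAdaptedBasis J' c') :
    c'.orientation = - c.orientation := by
  have hdet : b.det ![b 0, -b 1, b 2, b 3] = -1 := by
    rw [basis_det_fin_four]
    simp only [Matrix.det_succ_row_zero, Fin.sum_univ_succ]
    simp [Matrix.of_apply, Fin.succAbove, Finsupp.single_apply]
  obtain ⟨b', hb'⟩ := exists_basis_of_det_ne_zero b (v := ![b 0, -b 1, b 2, b 3])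
    (by rw [hdet]; norm_num)
  have had : IsAdaptedBasis J' b' := by
    constructor <;> simp [hb', h0, h2]
  rw [← hb.orientation_eq hJ hc, ← had.orientation_eq hJ' hc',
    ← Module.Basis.orientation_ne_iff_eq_neg, ne_comm, Ne,
    Module.Basis.orientation_eq_iff_det_pos, hb', hdet]
  norm_num

/-- Passing from `J'` to `-J'` changes the sign of two basis vectors, so the orientation is kept. -/
theorem opposite_neg {J J' : W →ₗ[ℝ] W}
    (hopp : ∀ c c' : Module.Basis (Fin 4) ℝ W, IsAdaptedBasis J c → IsAdaptedBasis J' c' →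
      c'.orientation = - c.orientation)
    {c c' : Module.Basis (Fin 4) ℝ W} (hc : IsAdaptedBasis J c) (hc' : IsAdaptedBasis (-J') c') :
    c'.orientation = - c.orientation := by
  have hdet : c'.det ![c' 0, -c' 1, c' 2, -c' 3] = 1 := by
    rw [basis_det_fin_four]
    simp only [Matrix.det_succ_row_zero, Fin.sum_univ_succ]
    simp [Matrix.of_apply, Fin.succAbove, Finsupp.single_apply]
  obtain ⟨b, hb⟩ := exists_basis_of_det_ne_zero c' (v := ![c' 0, -c' 1, c' 2, -c' 3])
    (by rw [hdet]; norm_num)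
  have had : IsAdaptedBasis J' b := by
    constructor <;> simp [hb, hc'.1, hc'.2]
  rw [← hopp c b hc had, Module.Basis.orientation_eq_iff_det_pos, hb, hdet]
  exact one_pos

end Orientation

section PlaneField

variable [FiniteDimensional ℝ V] {J : V →ₗ[ℝ] V} {D : Submodule ℝ V} {X : V}

theorem IsOrthogonalComplex.eq_span_pair (hJ : IsOrthogonalComplex J)
    (hD : Module.finrank ℝ D = 2) (hinv : ∀ u ∈ D, J u ∈ D) (hX : X ∈ D) (h0 : X ≠ 0) :
    D = Submodule.span ℝ {X, J X} := by
  have hli : LinearIndependent ℝ ![X, J X] := by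
    refine linearIndependent_of_ne_zero_of_inner_eq_zero (𝕜 := ℝ) ?_ ?_
    · intro i
      fin_cases i
      · simpa using h0
      · have := hJ.norm_map X
        simp only [Fin.mk_one, Matrix.cons_val_one, Matrix.cons_val_fin_one, ne_eq]
        rw [← norm_eq_zero, this, norm_eq_zero]
        exact h0
    · intro i j hij
      fin_cases i <;> fin_cases j <;>
        first
        | exact absurd rfl hij
        | simp [hJ.inner_self, real_inner_comm (J X) X]
  have h1 := finrank_span_eq_card hli
  rw [Matrix.range_cons_cons_empty, Fintype.card_fin] at h1
  refine (Submodule.eq_of_le_of_finrank_eq (Submodule.span_le.2 ?_) (by rw [h1, hD])).symm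
  rintro v (rfl | rfl)
  · exact hX
  · exact hinv _ hX

/-- One nonzero vector of `D` suffices, and need not be normalized; applied to a smooth section of
`D`, the formula shows that the projection is smooth. -/
theorem IsOrthogonalComplex.starProjection_eq (hJ : IsOrthogonalComplex J)
    (hD : Module.finrank ℝ D = 2) (hinv : ∀ u ∈ D, J u ∈ D) (hX : X ∈ D) (h0 : X ≠ 0) (v : V) :
    D.starProjection v = ((inner ℝ X v : ℝ) / inner ℝ X X) • X
      + ((inner ℝ (J X) v : ℝ) / inner ℝ X X) • J X := by
  refine Submodule.eq_starProjection_of_mem_of_inner_eq_zero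
    (D.add_mem (D.smul_mem _ hX) (D.smul_mem _ (hinv _ hX))) fun w hw ↦ ?_
  rw [hJ.eq_span_pair hD hinv hX h0, Submodule.mem_span_pair] at hw
  obtain ⟨a, b, rfl⟩ := hw
  have hXX : (inner ℝ X X : ℝ) ≠ 0 := inner_self_ne_zero.2 h0
  have h1 : (inner ℝ X (J X) : ℝ) = 0 := by rw [real_inner_comm, hJ.inner_self]
  simp only [inner_sub_left, inner_add_left, inner_add_right, real_inner_smul_left,
    real_inner_smul_right, hJ.inner_self, hJ.orthogonal, h1, real_inner_comm X v,
    real_inner_comm (J X) v]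
  field_simp
  ring

end PlaneField

/-! ### Opposite orientations force commutation. -/

section Commute

variable {J J' : V →ₗ[ℝ] V}

theorem not_orientation_eq_of_det_pos
    (hopp : ∀ c c' : Module.Basis (Fin 4) ℝ V, IsAdaptedBasis J c → IsAdaptedBasis J' c' →
      c'.orientation = - c.orientation)
    {b : Module.Basis (Fin 4) ℝ V} (hb : IsAdaptedBasis J b) (u v : V) :
    ¬ 0 < b.det ![u, J' u, v, J' v] := by
  intro h
  obtain ⟨b', hb'⟩ := exists_basis_of_det_ne_zero b h.ne'
  have had : IsAdaptedBasis J' b' := by constructor <;> simp [hb']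
  have h1 := hopp b b' hb had
  rw [← hb', ← Module.Basis.orientation_eq_iff_det_pos] at h
  rw [← h] at h1
  exact Module.Ray.ne_neg_self _ h1

/-- Orthogonal complex structures which induce opposite orientations on a four-dimensional space
commute. -/
theorem commute_of_opposite [FiniteDimensional ℝ V] (hV : Module.finrank ℝ V = 4)
    (hJ : IsOrthogonalComplex J) (hJ' : IsOrthogonalComplex J')
    (hopp : ∀ c c' : Module.Basis (Fin 4) ℝ V, IsAdaptedBasis J c → IsAdaptedBasis J' c' →
      c'.orientation = - c.orientation) (u : V) : J (J' u) = J' (J u) := by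
  obtain ⟨e, he1, he3⟩ := hJ.exists_orthonormalBasis_first hV
  have hJe1 : J (e 1) = - e 0 := by rw [he1, hJ.sq]
  have hJe3 : J (e 3) = - e 2 := by rw [he3, hJ.sq]
  have skew (i j : Fin 4) : (inner ℝ (e i) (J' (e j)) : ℝ) = - inner ℝ (e j) (J' (e i)) := by
    rw [real_inner_comm, hJ'.inner_left]
  have diag (i : Fin 4) : (inner ℝ (e i) (J' (e i)) : ℝ) = 0 := by
    rw [real_inner_comm, hJ'.inner_self]
  obtain ⟨a, ha⟩ : ∃ a, a = (inner ℝ (e 1) (J' (e 0)) : ℝ) := ⟨_, rfl⟩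
  obtain ⟨b, hb⟩ : ∃ b, b = (inner ℝ (e 2) (J' (e 0)) : ℝ) := ⟨_, rfl⟩
  obtain ⟨c, hc⟩ : ∃ c, c = (inner ℝ (e 3) (J' (e 0)) : ℝ) := ⟨_, rfl⟩
  obtain ⟨d, hd⟩ : ∃ d, d = (inner ℝ (e 2) (J' (e 1)) : ℝ) := ⟨_, rfl⟩
  obtain ⟨g, hg⟩ : ∃ g, g = (inner ℝ (e 3) (J' (e 1)) : ℝ) := ⟨_, rfl⟩
  obtain ⟨h, hh⟩ : ∃ h, h = (inner ℝ (e 3) (J' (e 2)) : ℝ) := ⟨_, rfl⟩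
  have k0 : J' (e 0) = a • e 1 + b • e 2 + c • e 3 := by
    rw [← e.sum_repr' (J' (e 0)), Fin.sum_univ_four, diag 0, ← ha, ← hb, ← hc]
    module
  have k1 : J' (e 1) = (-a) • e 0 + d • e 2 + g • e 3 := by
    rw [← e.sum_repr' (J' (e 1)), Fin.sum_univ_four, diag 1, skew 0 1, ← ha, ← hd, ← hg]
    module
  have k2 : J' (e 2) = (-b) • e 0 + (-d) • e 1 + h • e 3 := by
    rw [← e.sum_repr' (J' (e 2)), Fin.sum_univ_four, diag 2, skew 0 2, skew 1 2, ← hb, ← hd, ← hh]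
    module
  have k3 : J' (e 3) = (-c) • e 0 + (-g) • e 1 + (-h) • e 2 := by
    rw [← e.sum_repr' (J' (e 3)), Fin.sum_univ_four, diag 3, skew 0 3, skew 1 3, skew 2 3,
      ← hc, ← hg, ← hh]
    module
  have on (i j : Fin 4) : (inner ℝ (e i) (e j) : ℝ) = if i = j then 1 else 0 :=
    orthonormal_iff_ite.1 e.orthonormal i j
  have n0 := hJ'.orthogonal (e 0) (e 0)
  have n1 := hJ'.orthogonal (e 1) (e 1)
  have n2 := hJ'.orthogonal (e 2) (e 2)
  have n3 := hJ'.orthogonal (e 3) (e 3)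
  have o1 := hJ'.orthogonal (e 0) (e 1)
  have o2 := hJ'.orthogonal (e 0) (e 2)
  have o3 := hJ'.orthogonal (e 0) (e 3)
  simp only [k0, k1, k2, k3, inner_add_left, inner_add_right, real_inner_smul_left,
    real_inner_smul_right, on] at n0 n1 n2 n3 o1 o2 o3
  simp at n0 n1 n2 n3 o1 o2 o3
  set s := a * h - b * g + c * d with hs
  have r1 : h = s * a := by linear_combination (-h) * n0 - b * o3 + c * o2
  have r2 : g = -(s * b) := by linear_combination (-g) * n0 - a * o3 + c * o1
  have r3 : d = s * c := by linear_combination (-d) * n0 - a * o2 + b * o1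
  have hs2 : s ^ 2 = 1 := by
    have : d ^ 2 + g ^ 2 + h ^ 2 = 1 := by linear_combination (n1 + n2 + n3 - n0) / 2
    rw [r1, r2, r3] at this
    linear_combination this - s ^ 2 * n0
  have hadapt : IsAdaptedBasis J e.toBasis := by
    constructor <;> simp [he1, he3]
  rcases mul_self_eq_one_iff.1 ((sq s).symm.trans hs2) with h1 | h1
  -- For `s = 1`, the determinants `a² + c²` and `b² + c²` would both be nonpositive, against `a² +
  -- b² + c² = 1`.
  · exfalso
    rw [h1, one_mul] at r1 r2 r3
    have nj (i j : Fin 4) : e.toBasis.repr (e i) j = if i = j then 1 else 0 := by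
      rw [← e.coe_toBasis, e.toBasis.repr_self, Finsupp.single_apply]
    have d1 : e.toBasis.det ![e 0, J' (e 0), e 2, J' (e 2)] = a ^ 2 + c ^ 2 := by
      rw [basis_det_fin_four]
      simp only [Matrix.det_succ_row_zero, Fin.sum_univ_succ]
      simp [Fin.succAbove, k0, k2, r1, r3, -OrthonormalBasis.coe_toBasis_repr_apply, nj]
      ring
    have d2 : e.toBasis.det ![e 0, J' (e 0), e 1, J' (e 1)] = b ^ 2 + c ^ 2 := by
      rw [basis_det_fin_four]
      simp only [Matrix.det_succ_row_zero, Fin.sum_univ_succ]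
      simp [Fin.succAbove, k0, k1, r2, r3, -OrthonormalBasis.coe_toBasis_repr_apply, nj]
      ring
    have p1 := not_orientation_eq_of_det_pos hopp hadapt (e 0) (e 2)
    have p2 := not_orientation_eq_of_det_pos hopp hadapt (e 0) (e 1)
    rw [d1] at p1
    rw [d2] at p2
    nlinarith
  · rw [h1] at r1 r2 r3
    have : J ∘ₗ J' = J' ∘ₗ J := by
      refine e.toBasis.ext fun i ↦ ?_
      fin_cases i <;> simp [k0, k1, k2, k3, ← he1, ← he3, hJe1, hJe3] <;>
      simp only [r1, r2, r3] <;> module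
    exact DFunLike.congr_fun this u

/-- For commuting orthogonal complex structures, `J J'` is `-1` on the orthogonal complement of
`ker (J J' - 1)`. -/
theorem apply_apply_of_mem_orthogonal (hJ : IsOrthogonalComplex J) (hJ' : IsOrthogonalComplex J')
    (hcomm : ∀ u, J (J' u) = J' (J u)) {D : Submodule ℝ V} (hD : ∀ u, u ∈ D ↔ J (J' u) = u)
    {v : V} (hv : v ∈ Dᗮ) : J (J' v) = -v := by
  -- `J J'` is an involution, so `J J' v + v` is fixed by it; `J J'` is symmetric, so this vector is
  -- also orthogonal to `D`, hence zero.
  have hmem : J (J' v) + v ∈ D := by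
    rw [hD, map_add, map_add, ← hcomm (J' v), hJ'.sq, map_neg, map_neg, hJ.sq, neg_neg, add_comm]
  have hmem' : J (J' v) + v ∈ Dᗮ := by
    refine Dᗮ.add_mem ?_ hv
    intro u hu
    have h1 := hJ.inner_left u (J' v)
    have h2 := hJ'.inner_left (J u) v
    have h3 : (inner ℝ u v : ℝ) = 0 := hv u hu
    rw [← hcomm, (hD u).1 hu] at h2
    linarith
  exact eq_neg_of_add_eq_zero_left
    (Submodule.disjoint_def.1 D.orthogonal_disjoint _ hmem hmem')

/-- `D` and its complement are `J`-invariant, so neither is a line; `D = 0` would give `J' = J`, and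
a zero complement `J' = -J`. -/
theorem finrank_eigenspace_eq_two [FiniteDimensional ℝ V] (hV : Module.finrank ℝ V = 4)
    (hJ : IsOrthogonalComplex J) (hJ' : IsOrthogonalComplex J')
    (hcomm : ∀ u, J (J' u) = J' (J u)) (hne : J' ≠ J) (hne' : J' ≠ -J)
    {D : Submodule ℝ V} (hD : ∀ u, u ∈ D ↔ J (J' u) = u) : Module.finrank ℝ D = 2 := by
  have hinv : ∀ u ∈ D, J u ∈ D := fun u hu ↦ by
    rw [hD, ← hcomm, (hD u).1 hu]
  have hinv' : ∀ u ∈ Dᗮ, J u ∈ Dᗮ := fun u hu w hw ↦ by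
    have h1 := hJ.inner_left w u
    have h2 : (inner ℝ (J w) u : ℝ) = 0 := hu _ (hinv w hw)
    linarith
  have h1 := hJ.finrank_ne_one hinv
  have h2 := hJ.finrank_ne_one hinv'
  have h3 := D.finrank_add_finrank_orthogonal
  have inj {x y : V} (h : J x = J y) : x = y := by
    have := congrArg J h
    rwa [hJ.sq, hJ.sq, neg_inj] at this
  have h0 : Module.finrank ℝ D ≠ 0 := by
    intro h
    rw [Submodule.finrank_eq_zero] at h
    refine hne (LinearMap.ext fun v ↦ inj ?_)
    rw [hJ.sq, apply_apply_of_mem_orthogonal hJ hJ' hcomm hD (by simp [h])]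
  have h0' : Module.finrank ℝ Dᗮ ≠ 0 := by
    intro h
    rw [Submodule.finrank_eq_zero, Submodule.orthogonal_eq_bot_iff] at h
    refine hne' (LinearMap.ext fun v ↦ inj ?_)
    rw [(hD v).1 (by simp [h])]
    simp [hJ.sq]
  omega

end Commute

end Algebra

/-! ### Kähler curvature tensors at a point: QCH against `(G_2)`. -/

section CurvatureLike

variable {V : Type*} [NormedAddCommGroup V] [InnerProductSpace ℝ V]

/-- The algebraic properties of the curvature tensor of a Kähler manifold at a point. -/
structure IsKahlerCurvature (J : V →ₗ[ℝ] V) (R : V → V → V → V → ℝ) : Prop where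
  add : ∀ u v w z z', R u v w (z + z') = R u v w z + R u v w z'
  smul : ∀ (c : ℝ) u v w z, R u v w (c • z) = c * R u v w z
  swap_left : ∀ u v w z, R u v w z = - R v u w z
  swap_right : ∀ u v w z, R u v w z = - R u v z w
  bianchi : ∀ u v w z, R u v w z + R v w u z + R w u v z = 0
  invariant : ∀ u v w z, R u v (J w) (J z) = R u v w z

/-- The vector with the given coordinates in the family `b`. -/
def comb (b : Fin 4 → V) (x : Fin 4 → ℝ) : V :=
  x 0 • b 0 + x 1 • b 1 + x 2 • b 2 + x 3 • b 3

/-- The invariant two-form `e⁰ ∧ e¹` in coordinates. -/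
def formI (x y : Fin 4 → ℝ) : ℝ := x 0 * y 1 - x 1 * y 0
/-- The invariant two-form `e² ∧ e³` in coordinates. -/
def formII (x y : Fin 4 → ℝ) : ℝ := x 2 * y 3 - x 3 * y 2
/-- The invariant two-form `e⁰ ∧ e² + e¹ ∧ e³` in coordinates. -/
def formIII (x y : Fin 4 → ℝ) : ℝ := x 0 * y 2 - x 2 * y 0 + (x 1 * y 3 - x 3 * y 1)
/-- The invariant two-form `e⁰ ∧ e³ - e¹ ∧ e²` in coordinates. -/
def formIV (x y : Fin 4 → ℝ) : ℝ := x 0 * y 3 - x 3 * y 0 - (x 1 * y 2 - x 2 * y 1)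

namespace IsKahlerCurvature

variable {J : V →ₗ[ℝ] V} {R : V → V → V → V → ℝ}

/-- The classical octahedron argument with four Bianchi identities. Linearity is assumed in the last
slot only; this symmetry and the skew ones carry it to the others. -/
theorem pair_symm (h : IsKahlerCurvature J R) (u v w z : V) : R u v w z = R w z u v := by
  have b1 := h.bianchi u v w z
  have b2 := h.bianchi v w z u
  have b3 := h.bianchi w z u v
  have b4 := h.bianchi z u v w
  have s1 := h.swap_right v w z u
  have s2 := h.swap_right w z v u
  have s3 := h.swap_right z v w u
  have s4 := h.swap_right w u v z
  have s5 := h.swap_right z u w v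
  have s6 := h.swap_right u v z w
  have s7 := h.swap_left z v u w
  have s8 := h.swap_left u w z v
  have s9 := h.swap_right z v u w
  have s10 := h.swap_right u w z v
  have s11 := h.swap_left w u v z
  have s12 := h.swap_right v z u w
  have s13 := h.swap_left v z w u
  have s14 := h.swap_left v z u w
  linarith

/-- Invariance ties the six coefficients of a two-form by two relations, leaving a four-dimensional
space. -/
theorem two_form (b : Fin 4 → V) (hJ : ∀ u, J (J u) = -u) (h1 : b 1 = J (b 0))
    (h3 : b 3 = J (b 2)) {B : V → V → ℝ}
    (hadd : ∀ u v v', B u (v + v') = B u v + B u v') (hsmul : ∀ (c : ℝ) u v, B u (c • v) = c * B u v)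
    (hskew : ∀ u v, B u v = - B v u) (hinv : ∀ u v, B (J u) (J v) = B u v) (x y : Fin 4 → ℝ) :
    B (comb b x) (comb b y) = formI x y * B (b 0) (b 1) + formII x y * B (b 2) (b 3)
      + formIII x y * B (b 0) (b 2) + formIV x y * B (b 0) (b 3) := by
  have hadd' (u u' v : V) : B (u + u') v = B u v + B u' v := by
    rw [hskew, hadd, hskew u, hskew u']
    ring
  have hsmul' (c : ℝ) (u v : V) : B (c • u) v = c * B u v := by
    rw [hskew, hsmul, hskew u]
    ring
  have hd (u : V) : B u u = 0 := by linarith [hskew u u]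
  have e1 : B (b 1) (b 3) = B (b 0) (b 2) := by rw [h1, h3, hinv]
  have e2 : B (b 1) (b 2) = - B (b 0) (b 3) := by
    rw [h1, ← hinv (b 0), h3, hJ, ← neg_one_smul ℝ (b 2), hsmul]
    ring
  simp only [comb, hadd, hadd', hsmul, hsmul', hd, hskew (b 1) (b 0), hskew (b 2) (b 0),
    hskew (b 3) (b 0), hskew (b 2) (b 1), hskew (b 3) (b 1), hskew (b 3) (b 2), e1, e2,
    formI, formII, formIII, formIV]
  ring

/-- The components of the curvature in an adapted frame. -/
theorem apply_comb (h : IsKahlerCurvature J R) (hJ : ∀ u, J (J u) = -u) (b : Fin 4 → V)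
    (h1 : b 1 = J (b 0)) (h3 : b 3 = J (b 2)) :
    ∃ p₁ p₂ c m n p q s t k : ℝ, c = m + n ∧
      ∀ x y z w : Fin 4 → ℝ, R (comb b x) (comb b y) (comb b z) (comb b w) =
        p₁ * (formI x y * formI z w) + p₂ * (formII x y * formII z w)
        + c * (formI x y * formII z w + formII x y * formI z w)
        + m * (formIII x y * formIII z w) + n * (formIV x y * formIV z w)
        + k * (formIII x y * formIV z w + formIV x y * formIII z w)
        + p * (formI x y * formIII z w + formIII x y * formI z w)
        + q * (formI x y * formIV z w + formIV x y * formI z w)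
        + s * (formII x y * formIII z w + formIII x y * formII z w)
        + t * (formII x y * formIV z w + formIV x y * formII z w) := by
  have r (u v : V) (z w : Fin 4 → ℝ) := two_form b hJ h1 h3 (B := fun w z ↦ R u v w z)
    (h.add u v) (fun c ↦ h.smul c u v) (h.swap_right u v) (h.invariant u v) z w
  have l (u v : V) (z w : Fin 4 → ℝ) := two_form b hJ h1 h3 (B := fun w z ↦ R w z u v)
    (fun w z z' ↦ by simp only [h.pair_symm _ _ u v, h.add])
    (fun c w z ↦ by simp only [h.pair_symm _ _ u v, h.smul])
    (fun w z ↦ h.swap_left w z u v)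
    (fun w z ↦ by simp only [h.pair_symm _ _ u v, h.invariant]) z w
  refine ⟨R (b 0) (b 1) (b 0) (b 1), R (b 2) (b 3) (b 2) (b 3), R (b 0) (b 1) (b 2) (b 3),
    R (b 0) (b 2) (b 0) (b 2), R (b 0) (b 3) (b 0) (b 3), R (b 0) (b 1) (b 0) (b 2),
    R (b 0) (b 1) (b 0) (b 3), R (b 2) (b 3) (b 0) (b 2), R (b 2) (b 3) (b 0) (b 3),
    R (b 0) (b 2) (b 0) (b 3), ?_, fun x y z w ↦ ?_⟩
  · have b1 := h.bianchi (b 0) (b 1) (b 2) (b 3)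
    have i1 : R (b 1) (b 2) (b 0) (b 3) = - R (b 0) (b 3) (b 0) (b 3) := by
      have j1 : J (b 1) = (-1 : ℝ) • b 0 := by rw [h1, hJ, neg_one_smul]
      rw [h.pair_symm, ← h.invariant, ← h3, j1, h.swap_right, h.smul, h.swap_right]
      ring
    have i2 : R (b 2) (b 0) (b 1) (b 3) = - R (b 0) (b 2) (b 0) (b 2) := by
      rw [h.swap_left, h1, h3, h.invariant]
    linarith
  · rw [r, l, l, l, l, h.pair_symm (b 2) (b 3) (b 0) (b 1),
      h.pair_symm (b 0) (b 2) (b 0) (b 1), h.pair_symm (b 0) (b 3) (b 0) (b 1),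
      h.pair_symm (b 0) (b 2) (b 2) (b 3), h.pair_symm (b 0) (b 3) (b 2) (b 3),
      h.pair_symm (b 0) (b 3) (b 0) (b 2)]
    ring

end IsKahlerCurvature

theorem apply_comb_of_adapted {J : V →ₗ[ℝ] V} (hJ : ∀ u, J (J u) = -u) {b : Fin 4 → V}
    (h1 : b 1 = J (b 0)) (h3 : b 3 = J (b 2)) (x : Fin 4 → ℝ) :
    J (comb b x) = comb b ![-x 1, x 0, -x 3, x 2] := by
  have h1' : J (b 1) = - b 0 := by rw [h1, hJ]
  have h3' : J (b 3) = - b 2 := by rw [h3, hJ]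
  simp only [comb, map_add, map_smul, h1', h3', ← h1, ← h3]
  simp
  module

theorem exists_comb_eq (b : OrthonormalBasis (Fin 4) ℝ V) (v : V) : ∃ x, v = comb b x := by
  refine ⟨fun i ↦ inner ℝ (b i) v, ?_⟩
  rw [comb, ← Fin.sum_univ_four (f := fun i ↦ (inner ℝ (b i) v : ℝ) • b i), b.sum_repr']

theorem norm_sq_comb (b : OrthonormalBasis (Fin 4) ℝ V) (x : Fin 4 → ℝ) :
    ‖comb b x‖ ^ 2 = x 0 ^ 2 + x 1 ^ 2 + x 2 ^ 2 + x 3 ^ 2 := by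
  have on (i j : Fin 4) : (inner ℝ (b i) (b j) : ℝ) = if i = j then 1 else 0 :=
    orthonormal_iff_ite.1 b.orthonormal i j
  rw [← real_inner_self_eq_norm_sq]
  simp only [comb, inner_add_left, inner_add_right, real_inner_smul_left,
    real_inner_smul_right, on]
  simp
  ring

variable [FiniteDimensional ℝ V]

theorem norm_sq_starProjection_comb {D : Submodule ℝ V} (b : OrthonormalBasis (Fin 4) ℝ V)
    (h0 : b 0 ∈ D) (h1 : b 1 ∈ D) (h2 : b 2 ∈ Dᗮ) (h3 : b 3 ∈ Dᗮ) (x : Fin 4 → ℝ) :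
    ‖D.starProjection (comb b x)‖ ^ 2 = x 0 ^ 2 + x 1 ^ 2 := by
  have : D.starProjection (comb b x) = comb b ![x 0, x 1, 0, 0] := by
    simp only [comb, map_add, map_smul, Submodule.starProjection_eq_self_iff.2 h0,
      Submodule.starProjection_eq_self_iff.2 h1,
      (Submodule.starProjection_apply_eq_zero_iff D).2 h2,
      (Submodule.starProjection_apply_eq_zero_iff D).2 h3]
    simp
  rw [this, norm_sq_comb]
  simp

/-- The pointwise QCH condition implies the second Gray condition. -/
theorem gray_of_qch {J J' : V →ₗ[ℝ] V} (hJ : IsOrthogonalComplex J)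
    {R : V → V → V → V → ℝ} (hR : IsKahlerCurvature J R) {D : Submodule ℝ V}
    (b : OrthonormalBasis (Fin 4) ℝ V) (hb1 : b 1 = J (b 0)) (hb3 : b 3 = J (b 2))
    (h0 : b 0 ∈ D) (h1 : b 1 ∈ D) (h2 : b 2 ∈ Dᗮ) (h3 : b 3 ∈ Dᗮ)
    (hJ' : ∀ x, J' (comb b x) = comb b ![x 1, -x 0, -x 3, x 2])
    (hqch : ∀ X Y : V, ‖X‖ = 1 → ‖Y‖ = 1 → ‖D.starProjection X‖ = ‖D.starProjection Y‖ →
      R X (J X) (J X) X = R Y (J Y) (J Y) Y) (X Y Z W : V) :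
    R X Y Z W - R (J' X) (J' Y) Z W = R (J' X) Y (J' Z) W + R (J' X) Y Z (J' W) := by
  obtain ⟨p₁, p₂, c, m, n, p, q, s, t, k, hc, hform⟩ := hR.apply_comb hJ.sq b hb1 hb3
  have key (x y : Fin 4 → ℝ) (hx : x 0 ^ 2 + x 1 ^ 2 + x 2 ^ 2 + x 3 ^ 2 = 1)
      (hy : y 0 ^ 2 + y 1 ^ 2 + y 2 ^ 2 + y 3 ^ 2 = 1)
      (hxy : x 0 ^ 2 + x 1 ^ 2 = y 0 ^ 2 + y 1 ^ 2) := by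
    refine hqch (comb b x) (comb b y) ?_ ?_ ?_
    · rw [← sq_eq_sq₀ (norm_nonneg _) zero_le_one, norm_sq_comb, hx, one_pow]
    · rw [← sq_eq_sq₀ (norm_nonneg _) zero_le_one, norm_sq_comb, hy, one_pow]
    · rw [← sq_eq_sq₀ (norm_nonneg _) (norm_nonneg _), norm_sq_starProjection_comb b h0 h1 h2 h3,
        norm_sq_starProjection_comb b h0 h1 h2 h3, hxy]
  simp only [apply_comb_of_adapted hJ.sq hb1 hb3, hform, formI, formII, formIII, formIV] at key
  -- The two test vectors share their `D`-component and differ by a rotation or reflection in the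
  -- complement. The `p₁`, `p₂` and `c` terms depend on norms only and cancel.
  have key' (x₀ x₂ x₃ y₂ y₃ : ℝ) (hx : x₀ ^ 2 + (x₂ ^ 2 + x₃ ^ 2) = 1)
      (hxy : y₂ ^ 2 + y₃ ^ 2 = x₂ ^ 2 + x₃ ^ 2) :
      m * (x₀ ^ 2 * x₃ ^ 2) + n * (x₀ ^ 2 * x₂ ^ 2) - 2 * k * (x₀ ^ 2 * x₂ * x₃)
        - p * (x₀ ^ 3 * x₃) + q * (x₀ ^ 3 * x₂) - s * (x₀ * (x₂ ^ 2 + x₃ ^ 2) * x₃)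
        + t * (x₀ * (x₂ ^ 2 + x₃ ^ 2) * x₂) =
      m * (x₀ ^ 2 * y₃ ^ 2) + n * (x₀ ^ 2 * y₂ ^ 2) - 2 * k * (x₀ ^ 2 * y₂ * y₃)
        - p * (x₀ ^ 3 * y₃) + q * (x₀ ^ 3 * y₂) - s * (x₀ * (y₂ ^ 2 + y₃ ^ 2) * y₃)
        + t * (x₀ * (y₂ ^ 2 + y₃ ^ 2) * y₂) := by
    have := key ![x₀, 0, x₂, x₃] ![x₀, 0, y₂, y₃] (by simp; linarith) (by simp; linarith) (by simp)
    simp at this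
    linear_combination (-1 / 4) * this + (p₂ * (y₂ ^ 2 + y₃ ^ 2 + x₂ ^ 2 + x₃ ^ 2) / 4
      + c * x₀ ^ 2 / 2) * hxy
  -- Rational points from the triple 3, 4, 5. Sign changes isolate the odd terms, at two radii to
  -- separate `q` from `t` and `p` from `s`; `g5` compares `e₂` with `e₃` and gives `n = m`; `g6`
  -- uses an oblique vector to detect `k`.
  have g1 := key' (3/5) (4/5) 0 (-4/5) 0 (by norm_num) (by norm_num)
  have g2 := key' (4/5) (3/5) 0 (-3/5) 0 (by norm_num) (by norm_num)
  have g3 := key' (3/5) 0 (4/5) 0 (-4/5) (by norm_num) (by norm_num)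
  have g4 := key' (4/5) 0 (3/5) 0 (-3/5) (by norm_num) (by norm_num)
  have g5 := key' (3/5) (4/5) 0 0 (4/5) (by norm_num) (by norm_num)
  have g6 := key' (3/5) (12/25) (16/25) (12/25) (-16/25) (by norm_num) (by norm_num)
  have e1 : q = 0 := by linarith
  have e2 : t = 0 := by linarith
  have e3 : p = 0 := by linarith
  have e4 : s = 0 := by linarith
  subst e1 e2 e3 e4
  have e5 : n = m := by linarith
  have e6 : k = 0 := by linarith
  subst e5 e6 hc
  obtain ⟨x, rfl⟩ := exists_comb_eq b X
  obtain ⟨y, rfl⟩ := exists_comb_eq b Y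
  obtain ⟨z, rfl⟩ := exists_comb_eq b Z
  obtain ⟨w, rfl⟩ := exists_comb_eq b W
  simp only [hJ', hform, formI, formII, formIII, formIV]
  simp
  ring

/-- The second Gray condition implies the pointwise QCH condition. -/
theorem qch_of_gray {J J' : V →ₗ[ℝ] V} (hJ : IsOrthogonalComplex J)
    {R : V → V → V → V → ℝ} (hR : IsKahlerCurvature J R) {D : Submodule ℝ V}
    (b : OrthonormalBasis (Fin 4) ℝ V) (hb1 : b 1 = J (b 0)) (hb3 : b 3 = J (b 2))
    (h0 : b 0 ∈ D) (h1 : b 1 ∈ D) (h2 : b 2 ∈ Dᗮ) (h3 : b 3 ∈ Dᗮ)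
    (hJ' : ∀ x, J' (comb b x) = comb b ![x 1, -x 0, -x 3, x 2])
    (hgray : ∀ X Y Z W : V,
      R X Y Z W - R (J' X) (J' Y) Z W = R (J' X) Y (J' Z) W + R (J' X) Y Z (J' W)) (X Y : V)
    (hX : ‖X‖ = 1) (hY : ‖Y‖ = 1) (hXY : ‖D.starProjection X‖ = ‖D.starProjection Y‖) :
    R X (J X) (J X) X = R Y (J Y) (J Y) Y := by
  obtain ⟨p₁, p₂, c, m, n, p, q, s, t, k, hc, hform⟩ := hR.apply_comb hJ.sq b hb1 hb3
  -- The six evaluations yield, in order, `m = n` and the vanishing of `k`, `p`, `q`, `s`, `t`.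
  have g1 := hgray (comb b ![1, 0, 0, 0]) (comb b ![0, 0, 1, 0]) (comb b ![1, 0, 0, 0])
    (comb b ![0, 0, 1, 0])
  have g2 := hgray (comb b ![1, 0, 0, 0]) (comb b ![0, 0, 1, 0]) (comb b ![1, 0, 0, 0])
    (comb b ![0, 0, 0, 1])
  have g3 := hgray (comb b ![1, 0, 0, 0]) (comb b ![0, 0, 1, 0]) (comb b ![1, 0, 0, 0])
    (comb b ![0, 1, 0, 0])
  have g4 := hgray (comb b ![1, 0, 0, 0]) (comb b ![0, 0, 0, 1]) (comb b ![1, 0, 0, 0])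
    (comb b ![0, 1, 0, 0])
  have g5 := hgray (comb b ![1, 0, 0, 0]) (comb b ![0, 0, 1, 0]) (comb b ![0, 0, 1, 0])
    (comb b ![0, 0, 0, 1])
  have g6 := hgray (comb b ![1, 0, 0, 0]) (comb b ![0, 0, 0, 1]) (comb b ![0, 0, 1, 0])
    (comb b ![0, 0, 0, 1])
  simp only [hJ', hform, formI, formII, formIII, formIV] at g1 g2 g3 g4 g5 g6
  simp at g1 g2 g3 g4 g5 g6
  -- On the pair `(X, JX)` the squares of `formIII` and `formIV` add up to four times the product of
  -- the squared norms of the two components of `X`.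
  have H (x : Fin 4 → ℝ) : R (comb b x) (J (comb b x)) (J (comb b x)) (comb b x) =
      - (p₁ * (x 0 ^ 2 + x 1 ^ 2) ^ 2 + p₂ * (x 2 ^ 2 + x 3 ^ 2) ^ 2
        + (2 * c + 4 * n) * ((x 0 ^ 2 + x 1 ^ 2) * (x 2 ^ 2 + x 3 ^ 2))) := by
    rw [apply_comb_of_adapted hJ.sq hb1 hb3, hform]
    have : m = n := by linarith
    subst this
    have : k = 0 := by linarith
    subst this
    have : p = 0 := by linarith
    subst this
    have : q = 0 := by linarith
    subst this
    have : s = 0 := by linarith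
    subst this
    have : t = 0 := by linarith
    subst this
    simp only [formI, formII, formIII, formIV]
    simp
    ring
  obtain ⟨x, rfl⟩ := exists_comb_eq b X
  obtain ⟨y, rfl⟩ := exists_comb_eq b Y
  have e1 : x 0 ^ 2 + x 1 ^ 2 = y 0 ^ 2 + y 1 ^ 2 := by
    rw [← norm_sq_starProjection_comb b h0 h1 h2 h3, hXY, norm_sq_starProjection_comb b h0 h1 h2 h3]
  have e2 : x 2 ^ 2 + x 3 ^ 2 = y 2 ^ 2 + y 3 ^ 2 := by
    have a1 := norm_sq_comb b x
    have a2 := norm_sq_comb b y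
    rw [hX] at a1
    rw [hY] at a2
    linarith
  rw [H, H, e1, e2]

end CurvatureLike

/-! ### From pointwise algebra to fields on a Kähler surface. -/

section KahlerManifold

variable {M : Type*} [TopologicalSpace M] [ChartedSpace (EuclideanSpace ℝ (Fin 4)) M]
  [IsManifold (𝓡 4) ∞ M]

/-- An endomorphism field of the tangent bundle is smooth if it maps smooth vector fields to smooth
vector fields. -/
theorem contMDiff_of_apply
    {A : Π x : M, TangentSpace (𝓡 4) x →L[ℝ] TangentSpace (𝓡 4) x}
    (h : ∀ (x : M) (Y : Π y : M, TangentSpace (𝓡 4) y), SmoothNear Y x →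
      ContMDiffAt (𝓡 4) (𝓡 4).tangent ∞ (T% fun y ↦ A y (Y y)) x) :
    ContMDiff (𝓡 4)
      ((𝓡 4).prod 𝓘(ℝ, EuclideanSpace ℝ (Fin 4) →L[ℝ] EuclideanSpace ℝ (Fin 4))) ∞
      (fun x ↦ TotalSpace.mk' (EuclideanSpace ℝ (Fin 4) →L[ℝ] EuclideanSpace ℝ (Fin 4))
        (E := fun x : M ↦ TangentSpace (𝓡 4) x →L[ℝ] TangentSpace (𝓡 4) x) x (A x)) := by
  intro x
  rw [contMDiffAt_hom_bundle]
  refine ⟨contMDiffAt_id, ?_⟩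
  set E := EuclideanSpace ℝ (Fin 4)
  set t := trivializationAt E (TangentSpace (𝓡 4) : M → Type _) x with ht
  have hx : t.baseSet ∈ 𝓝 x :=
    t.open_baseSet.mem_nhds (FiberBundle.mem_baseSet_trivializationAt' x)
  set F : M → E →L[ℝ] E := fun y ↦ ContinuousLinearMap.inCoordinates E
    (TangentSpace (𝓡 4) : M → Type _) E (TangentSpace (𝓡 4) : M → Type _) x y x y (A y) with hF
  have happ (v : E) : ContMDiffAt (𝓡 4) 𝓘(ℝ, E) ∞ (fun y ↦ F y v) x := by
    have h1 := h x _ (smoothNear_extend (E := E) (t.symm x v))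
    rw [contMDiffAt_section] at h1
    refine h1.congr_of_eventuallyEq ?_
    filter_upwards [hx] with y hy
    rw [hF]
    simp only
    rw [ContinuousLinearMap.inCoordinates_eq hy hy]
    simp only [extend, ← ht]
    rw [t.apply_mk_symm (mem_of_mem_nhds hx)]
    rfl
  -- In finite dimension an operator is recovered linearly from its values on a basis, so smoothness
  -- of each `F y v` is enough.
  have hsum : F = fun y ↦ ∑ i : Fin 4, ContinuousLinearMap.smulRightL ℝ E E
      (EuclideanSpace.proj i) (F y (EuclideanSpace.single i 1)) := by
    funext y
    refine ContinuousLinearMap.coe_injective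
      ((EuclideanSpace.basisFun (Fin 4) ℝ).toBasis.ext fun i ↦ ?_)
    simp [Finset.sum_ite_eq]
  rw [hsum]
  refine ContMDiffAt.sum fun i _ ↦ ?_
  exact (ContinuousLinearMap.contMDiff _).contMDiffAt.comp x (happ _)

variable [RiemannianBundle (fun x : M ↦ TangentSpace (𝓡 4) x)]
  [IsContMDiffRiemannianBundle (𝓡 4) ∞ (EuclideanSpace ℝ (Fin 4))
    (fun x : M ↦ TangentSpace (𝓡 4) x)]
  {J J' : Π x : M, TangentSpace (𝓡 4) x →L[ℝ] TangentSpace (𝓡 4) x}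

theorem IsAlmostHermitian.smoothNear (hJ : IsAlmostHermitian J)
    {Y : Π y : M, TangentSpace (𝓡 4) y} {x : M} (hY : SmoothNear Y x) :
    SmoothNear (fun y ↦ J y (Y y)) x := by
  filter_upwards [hY] with y h
  exact (hJ.smooth y).clm_bundle_apply h

theorem IsAlmostHermitian.isOrthogonalComplex (hJ : IsAlmostHermitian J) (x : M) :
    IsOrthogonalComplex (V := TangentSpace (𝓡 4) x) (J x).toLinearMap where
  sq := hJ.sq x
  orthogonal := hJ.orthogonal x

theorem IsKahler.curvatureField_apply (hJ : IsKahler J) {X Y Z : Π y : M, TangentSpace (𝓡 4) y}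
    {x : M} (hX : SmoothNear X x) (hY : SmoothNear Y x) (hZ : SmoothNear Z x) :
    curvatureField X Y (fun y ↦ J y (Z y)) x = J x (curvatureField X Y Z x) := by
  have hJZ := hJ.smoothNear hZ
  have key {X Y : Π y : M, TangentSpace (𝓡 4) y} (hX : SmoothNear X x) (hY : SmoothNear Y x) :
      leviCivita (𝓡 4) M (fun y ↦ leviCivita (𝓡 4) M (fun y ↦ J y (Z y)) y (Y y)) x (X x) =
        J x (leviCivita (𝓡 4) M (fun y ↦ leviCivita (𝓡 4) M Z y (Y y)) x (X x)) := by
    rw [← hJ.parallel x _ (hY.leviCivita hZ).mdiffAt,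
      leviCivita_congr (hY.leviCivita hJZ) (Y' := fun y ↦ J y (leviCivita (𝓡 4) M Z y (Y y)))]
    filter_upwards [hZ.eventually] with y hy
    exact hJ.parallel y Z hy.mdiffAt _
  simp only [curvatureField]
  rw [key hX hY, key hY hX, hJ.parallel x Z hZ.mdiffAt, map_sub, map_sub]

theorem IsKahler.isKahlerCurvature (hJ : IsKahler J) (x : M) :
    IsKahlerCurvature (V := TangentSpace (𝓡 4) x) (J x).toLinearMap (riemann x) where
  add u v w z z' := by simp only [riemann, inner_add_right]
  smul c u v w z := by simp only [riemann, real_inner_smul_right]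
  swap_left := riemann_swap_left x
  swap_right := riemann_swap_right x
  bianchi := riemann_bianchi x
  invariant u v w z := by
    have h1 := hJ.curvatureField_apply (smoothNear_extend u) (smoothNear_extend v)
      (smoothNear_extend w)
    -- `J` applied to the extension of `w` and the extension of `J w` are different fields with the
    -- same value at `x`.
    have h2 := curvatureField_congr (smoothNear_extend u) (smoothNear_extend v)
      (hJ.smoothNear (smoothNear_extend w)) (smoothNear_extend (J x w)) (by simp)
    simp only [riemann, ContinuousLinearMap.coe_coe]
    rw [← h2, h1, hJ.orthogonal]

theorem finrank_tangentSpace (x : M) : Module.finrank ℝ (TangentSpace (𝓡 4) x) = 4 :=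
  finrank_euclideanSpace_fin (𝕜 := ℝ) (n := 4)

theorem mem_kerSub {x : M} {u : TangentSpace (𝓡 4) x} :
    u ∈ kerSub J J' x ↔ J x (J' x u) = u := by
  simp [kerSub, sub_eq_zero]

theorem kerAdd_eq_kerSub_neg : kerAdd J J' = kerSub J (fun x ↦ -J' x) := by
  ext x u
  simp only [kerAdd, kerSub, LinearMap.mem_ker]
  simp [sub_eq_zero, add_eq_zero_iff_eq_neg, neg_eq_iff_eq_neg]

theorem IsAlmostHermitian.neg (hJ : IsAlmostHermitian J) :
    IsAlmostHermitian (fun x ↦ -J x) where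
  smooth := hJ.smooth.neg_section
  sq x u := by simp [hJ.sq]
  orthogonal x u v := by simp [hJ.orthogonal]

/-- Every term of the condition contains `J'` an even number of times. -/
theorem SecondGrayCondition.neg (h : SecondGrayCondition J')
    (hR : ∀ x : M, IsKahlerCurvature (V := TangentSpace (𝓡 4) x) (J x).toLinearMap (riemann x)) :
    SecondGrayCondition (fun x ↦ -J' x) := by
  intro x X Y Z W
  have hx := hR x
  have n4 (u v w z : TangentSpace (𝓡 4) x) : riemann x u v w (-z) = - riemann x u v w z := by
    rw [← neg_one_smul ℝ z, hx.smul]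
    ring
  have n3 (u v w z : TangentSpace (𝓡 4) x) : riemann x u v (-w) z = - riemann x u v w z := by
    rw [hx.swap_right, n4, ← hx.swap_right]
  have n2 (u v w z : TangentSpace (𝓡 4) x) : riemann x u (-v) w z = - riemann x u v w z := by
    rw [hx.pair_symm, n4, ← hx.pair_symm]
  have n1 (u v w z : TangentSpace (𝓡 4) x) : riemann x (-u) v w z = - riemann x u v w z := by
    rw [hx.swap_left, n2, ← hx.swap_left]
  have := h x X Y Z W
  simpa [n1, n2, n3, n4] using this

end KahlerManifold

section Algebra

variable {V : Type*} [NormedAddCommGroup V] [InnerProductSpace ℝ V]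

theorem apply_comb_of_opposite {J J' : V →ₗ[ℝ] V} (hJ : ∀ u, J (J u) = -u) {D : Submodule ℝ V}
    (hD : ∀ u ∈ D, J' u = - J u) (hD' : ∀ u ∈ Dᗮ, J' u = J u) {b : Fin 4 → V}
    (hb1 : b 1 = J (b 0)) (hb3 : b 3 = J (b 2))
    (h0 : b 0 ∈ D) (h1 : b 1 ∈ D) (h2 : b 2 ∈ Dᗮ) (h3 : b 3 ∈ Dᗮ) (x : Fin 4 → ℝ) :
    J' (comb b x) = comb b ![x 1, -x 0, -x 3, x 2] := by
  have h1' : J (b 1) = - b 0 := by rw [hb1, hJ]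
  have h3' : J (b 3) = - b 2 := by rw [hb3, hJ]
  simp only [comb, map_add, map_smul, hD _ h0, hD _ h1, hD' _ h2, hD' _ h3, h1', h3', ← hb1, ← hb3]
  simp
  module

end Algebra

/-! ### The correspondence between negative structures and distributions. -/

section QCH

variable {M : Type*} [TopologicalSpace M] [ChartedSpace (EuclideanSpace ℝ (Fin 4)) M]
  [IsManifold (𝓡 4) ∞ M]
  [RiemannianBundle (fun x : M ↦ TangentSpace (𝓡 4) x)]
  [IsContMDiffRiemannianBundle (𝓡 4) ∞ (EuclideanSpace ℝ (Fin 4))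
    (fun x : M ↦ TangentSpace (𝓡 4) x)]
  {J J' : Π x : M, TangentSpace (𝓡 4) x →L[ℝ] TangentSpace (𝓡 4) x}

theorem IsNegativeAlmostComplex.neg (h : IsNegativeAlmostComplex J J') :
    IsNegativeAlmostComplex J (fun x ↦ -J' x) where
  toIsAlmostHermitian := h.toIsAlmostHermitian.neg
  opposite x _ _ hc hc' := opposite_neg (J := (J x).toLinearMap) (J' := (J' x).toLinearMap)
    (h.opposite x) hc hc'

theorem IsNegativeAlmostComplex.commute (h : IsNegativeAlmostComplex J J')
    (hJ : IsAlmostHermitian J) (x : M) (u : TangentSpace (𝓡 4) x) :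
    J x (J' x u) = J' x (J x u) :=
  commute_of_opposite (finrank_tangentSpace x) (hJ.isOrthogonalComplex x)
    (h.isOrthogonalComplex x) (h.opposite x) u

theorem IsNegativeAlmostComplex.finrank_kerSub (h : IsNegativeAlmostComplex J J')
    (hJ : IsAlmostHermitian J) (x : M) : Module.finrank ℝ (kerSub J J' x) = 2 := by
  have hJx := hJ.isOrthogonalComplex x
  have hJx' := h.isOrthogonalComplex x
  obtain ⟨e, he1, he3⟩ := hJx.exists_orthonormalBasis_first (finrank_tangentSpace x)
  have had : IsAdaptedBasis (J x) e.toBasis := by constructor <;> simp [he1, he3]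
  have hne : (J' x).toLinearMap ≠ (J x).toLinearMap := by
    intro heq
    have had' : IsAdaptedBasis (J' x) e.toBasis := by
      rw [ContinuousLinearMap.coe_injective heq]
      exact had
    exact Module.Ray.ne_neg_self _ (h.opposite x _ _ had had')
  have hne' : (J' x).toLinearMap ≠ -(J x).toLinearMap := by
    intro heq
    have had' : IsAdaptedBasis (-J' x) e.toBasis := by
      have : -J' x = J x := by
        ext u
        have := DFunLike.congr_fun heq u
        simpa [neg_eq_iff_eq_neg] using this
      rw [this]
      exact had
    exact Module.Ray.ne_neg_self _ (h.neg.opposite x _ _ had had')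
  exact finrank_eigenspace_eq_two (finrank_tangentSpace x) hJx hJx' (h.commute hJ x) hne hne'
    (fun u ↦ mem_kerSub)

theorem IsNegativeAlmostComplex.map_kerSub (h : IsNegativeAlmostComplex J J')
    (hJ : IsAlmostHermitian J) (x : M) (u : TangentSpace (𝓡 4) x) (hu : u ∈ kerSub J J' x) :
    J x u ∈ kerSub J J' x := by
  rw [mem_kerSub] at hu ⊢
  rw [← h.commute hJ, hu]

theorem eventually_ne_zero {X : Π y : M, TangentSpace (𝓡 4) y} {x : M}
    (hX : SmoothNear X x) (h0 : X x ≠ 0) : ∀ᶠ y in 𝓝 x, X y ≠ 0 := by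
  have h1 : innerFun X X x ≠ 0 := inner_self_ne_zero.2 h0
  filter_upwards [(ContMDiffAt.continuousAt (hX.innerFun hX).self_of_nhds).eventually_ne h1]
    with y hy h
  exact hy (inner_self_eq_zero.2 h)

/-- For a negative almost complex structure, `ker (J J' - Id)` is a smooth plane field. -/
theorem IsNegativeAlmostComplex.isSmoothPlaneField_kerSub (h : IsNegativeAlmostComplex J J')
    (hJ : IsAlmostHermitian J) : IsSmoothPlaneField (kerSub J J') where
  finrank_eq := h.finrank_kerSub hJ
  smooth x := by
    obtain ⟨u, hu, hu1⟩ := IsOrthogonalComplex.exists_unit_mem (D := kerSub J J' x) (by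
      intro h0
      have := h.finrank_kerSub hJ x
      rw [h0] at this
      simp at this)
    set U : Π y : M, TangentSpace (𝓡 4) y := extend (EuclideanSpace ℝ (Fin 4)) u
    -- `1 + J J'` is twice the projection on `ker (J J' - Id)`, so `X` is a section of the kernel
    -- with value `2 u` at `x`; then `X` and `J X` span it nearby.
    set X : Π y : M, TangentSpace (𝓡 4) y := U + fun y ↦ J y (J' y (U y)) with hXdef
    have hU : SmoothNear U x := smoothNear_extend u
    have hX : SmoothNear X x := hU.add (hJ.smoothNear (h.smoothNear hU))
    have hX0 : X x ≠ 0 := by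
      simp only [hXdef, Pi.add_apply, U, extend_apply_self, mem_kerSub.1 hu]
      rw [← two_smul ℝ, smul_ne_zero_iff]
      exact ⟨two_ne_zero, fun h0 ↦ by simp [h0] at hu1⟩
    have hmem (y : M) : X y ∈ kerSub J J' y := by
      rw [mem_kerSub]
      simp only [hXdef, Pi.add_apply, map_add]
      rw [← h.commute hJ y (J' y (U y)), h.sq, map_neg, map_neg, hJ.sq, neg_neg, add_comm]
    obtain ⟨s, hs, hso, hxs⟩ := eventually_nhds_iff.1
      ((hX.and (hJ.smoothNear hX)).and (eventually_ne_zero hX hX0))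
    refine ⟨s, hso, hxs, X, fun y ↦ J y (X y), fun y hy ↦ (hs y hy).1.1.contMDiffWithinAt,
      fun y hy ↦ (hs y hy).1.2.contMDiffWithinAt, fun y hy ↦ ?_⟩
    exact (hJ.isOrthogonalComplex y).eq_span_pair (h.finrank_kerSub hJ y) (h.map_kerSub hJ y)
      (hmem y) (hs y hy).2

theorem IsKahler.isQCHWith_kerSub (hJ : IsKahler J) (h : IsNegativeAlmostComplex J J')
    (hG : SecondGrayCondition J') : IsQCHWith J (kerSub J J') where
  toIsSmoothPlaneField := h.isSmoothPlaneField_kerSub hJ.toIsAlmostHermitian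
  invariant := h.map_kerSub hJ.toIsAlmostHermitian
  curvature x X Y hX hY hXY := by
    have hJ₀ := hJ.toIsAlmostHermitian
    have hJx := hJ.isOrthogonalComplex x
    obtain ⟨b, hb1, hb3, h0, h1, h2, h3⟩ := hJx.exists_adapted_orthonormalBasis
      (finrank_tangentSpace x) (h.finrank_kerSub hJ₀ x) (h.map_kerSub hJ₀ x)
    refine qch_of_gray hJx (hJ.isKahlerCurvature x) b hb1 hb3 h0 h1 h2 h3
      (J' := (J' x).toLinearMap)
      (apply_comb_of_opposite hJx.sq (D := kerSub J J' x) (fun u hu ↦ ?_) (fun u hu ↦ ?_)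
        hb1 hb3 h0 h1 h2 h3) (hG x) X Y hX hY hXY
    · have := congrArg (J x) (mem_kerSub.1 hu)
      rw [hJ.sq] at this
      exact neg_eq_iff_eq_neg.1 this
    · have h4 := apply_apply_of_mem_orthogonal hJx (h.isOrthogonalComplex x)
        (h.commute hJ₀ x) (D := kerSub J J' x) (fun u ↦ mem_kerSub) hu
      have := congrArg (J x) h4
      simp only [ContinuousLinearMap.coe_coe] at this
      rw [hJ.sq, map_neg, neg_inj] at this
      exact this

/-- The almost complex structure which is `-J` on the distribution `D` and `J` on its orthogonal
complement. -/
def flip (J : Π x : M, TangentSpace (𝓡 4) x →L[ℝ] TangentSpace (𝓡 4) x)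
    (D : Π x : M, Submodule ℝ (TangentSpace (𝓡 4) x)) (x : M) :
    TangentSpace (𝓡 4) x →L[ℝ] TangentSpace (𝓡 4) x :=
  J x ∘L (ContinuousLinearMap.id ℝ (TangentSpace (𝓡 4) x) - (2 : ℝ) • (D x).starProjection)

variable {D : Π x : M, Submodule ℝ (TangentSpace (𝓡 4) x)}

theorem flip_apply (x : M) (u : TangentSpace (𝓡 4) x) :
    flip J D x u = J x (u - (2 : ℝ) • (D x).starProjection u) := by
  simp [flip]

theorem flip_apply_of_mem {x : M} {u : TangentSpace (𝓡 4) x} (hu : u ∈ D x) :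
    flip J D x u = - J x u := by
  rw [flip_apply, Submodule.starProjection_eq_self_iff.2 hu, two_smul, sub_add_cancel_left, map_neg]

theorem flip_apply_of_mem_orthogonal {x : M} {u : TangentSpace (𝓡 4) x} (hu : u ∈ (D x)ᗮ) :
    flip J D x u = J x u := by
  rw [flip_apply, (Submodule.starProjection_apply_eq_zero_iff (D x)).2 hu, smul_zero, sub_zero]

theorem IsQCHWith.isAlmostHermitian_flip (hJ : IsAlmostHermitian J) (hD : IsQCHWith J D) :
    IsAlmostHermitian (flip J D) where
  smooth := by
    refine contMDiff_of_apply fun x Y hY ↦ ?_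
    obtain ⟨s, hso, hxs, X, X', hX, -, hspan⟩ := hD.smooth x
    have hs : s ∈ 𝓝 x := hso.mem_nhds hxs
    have hXs : SmoothNear X x := by
      filter_upwards [hs] with y hy using hX.contMDiffAt (hso.mem_nhds hy)
    have hJX := hJ.smoothNear hXs
    -- Two fields spanning a plane cannot vanish. Thus `X` and `J X` already span `D`, and the
    -- second field can be dropped.
    have hne (y : M) (hy : y ∈ s) : X y ≠ 0 := by
      intro h0
      have h1 := hD.finrank_eq y
      have h2 := finrank_span_le_card (R := ℝ) ({X' y} : Set (TangentSpace (𝓡 4) y))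
      rw [hspan y hy, h0, Submodule.span_insert_zero] at h1
      rw [h1] at h2
      simp at h2
    have hmem (y : M) (hy : y ∈ s) : X y ∈ D y := by
      rw [hspan y hy]
      exact Submodule.subset_span (by simp)
    have hXX := hXs.innerFun hXs
    have hXX0 : innerFun X X x ≠ 0 := inner_self_ne_zero.2 (hne x hxs)
    have hf := ((hXs.innerFun hY).div hXX hXX0).const_mul 2
    have hg := ((hJX.innerFun hY).div hXX hXX0).const_mul 2
    have hZ := hJ.smoothNear ((hY.sub (hXs.smul hf)).sub (hJX.smul hg))
    refine hZ.self_of_nhds.congr_of_eventuallyEq ?_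
    filter_upwards [hs] with y hy
    rw [flip_apply, (hJ.isOrthogonalComplex y).starProjection_eq (hD.finrank_eq y)
      (hD.invariant y) (hmem y hy) (hne y hy)]
    congr 2
    simp only [Pi.sub_apply, Pi.smul_apply', innerFun, smul_add, smul_smul, sub_sub]
    rfl
  sq x u := by
    obtain ⟨p, hp, q, hq, rfl⟩ := (D x).exists_add_mem_mem_orthogonal u
    have hq' : J x q ∈ (D x)ᗮ := fun w hw ↦ by
      have h1 := (hJ.isOrthogonalComplex x).inner_left w q
      have h2 : (inner ℝ (J x w) q : ℝ) = 0 := hq _ (hD.invariant x w hw)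
      simp only [ContinuousLinearMap.coe_coe] at h1
      linarith
    rw [map_add, flip_apply_of_mem hp, flip_apply_of_mem_orthogonal hq, map_add, map_neg,
      flip_apply_of_mem (hD.invariant x p hp), flip_apply_of_mem_orthogonal hq', hJ.sq, hJ.sq,
      neg_neg, neg_add]
  orthogonal x u v := by
    -- Up to sign, `flip` is `J` composed with the orthogonal reflection in `D`, a composition of
    -- isometries.
    have h1 (w : TangentSpace (𝓡 4) x) :
        w - (2 : ℝ) • (D x).starProjection w = -(D x).reflection w := by
      rw [Submodule.reflection_apply, neg_sub, two_smul, two_nsmul]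
    rw [flip_apply, flip_apply, hJ.orthogonal, h1, h1, inner_neg_neg]
    exact (D x).reflection.inner_map_map u v

theorem IsQCHWith.isNegativeAlmostComplex_flip (hJ : IsAlmostHermitian J) (hD : IsQCHWith J D) :
    IsNegativeAlmostComplex J (flip J D) where
  toIsAlmostHermitian := hD.isAlmostHermitian_flip hJ
  opposite x c c' hc hc' := by
    have hJx := hJ.isOrthogonalComplex x
    obtain ⟨b, hb1, hb3, h0, h1, h2, h3⟩ := hJx.exists_adapted_orthonormalBasis
      (finrank_tangentSpace x) (hD.finrank_eq x) (hD.invariant x)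
    have had : IsAdaptedBasis (J x) b.toBasis := by constructor <;> simp [hb1, hb3]
    refine opposite_of_flip (J := (J x).toLinearMap) (J' := (flip J D x).toLinearMap) hJx.sq
      ((hD.isAlmostHermitian_flip hJ).sq x) had ?_ ?_ hc hc'
    · simpa [hb1] using flip_apply_of_mem h0
    · simpa [hb3] using flip_apply_of_mem_orthogonal h2

theorem kerSub_flip (hJ : IsAlmostHermitian J) :
    kerSub J (flip J D) = D := by
  ext x u
  rw [mem_kerSub, flip_apply, hJ.sq, neg_sub, sub_eq_iff_eq_add, ← two_smul ℝ u,
    (smul_right_injective _ (two_ne_zero (α := ℝ))).eq_iff, Submodule.starProjection_eq_self_iff]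

theorem IsQCHWith.secondGrayCondition_flip (hJ : IsKahler J) (hD : IsQCHWith J D) :
    SecondGrayCondition (flip J D) := by
  intro x
  have hJx := hJ.isOrthogonalComplex x
  obtain ⟨b, hb1, hb3, h0, h1, h2, h3⟩ := hJx.exists_adapted_orthonormalBasis
    (finrank_tangentSpace x) (hD.finrank_eq x) (hD.invariant x)
  exact gray_of_qch (J' := (flip J D x).toLinearMap) hJx (hJ.isKahlerCurvature x) b hb1 hb3
    h0 h1 h2 h3 (apply_comb_of_opposite hJx.sq (D := D x) (fun u hu ↦ flip_apply_of_mem hu)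
      (fun u hu ↦ flip_apply_of_mem_orthogonal hu) hb1 hb3 h0 h1 h2 h3) (hD.curvature x)

end QCH

end KahlerSurface

end

theorem mainTheorem2 {M : Type*} [TopologicalSpace M] [T2Space M] [SecondCountableTopology M]
    [ChartedSpace (EuclideanSpace ℝ (Fin 4)) M] [IsManifold (𝓡 4) ∞ M]
    [RiemannianBundle (fun x : M ↦ TangentSpace (𝓡 4) x)]
    [IsContMDiffRiemannianBundle (𝓡 4) ∞ (EuclideanSpace ℝ (Fin 4))
      (fun x : M ↦ TangentSpace (𝓡 4) x)]
    (J : Π x : M, TangentSpace (𝓡 4) x →L[ℝ] TangentSpace (𝓡 4) x)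
    (hJ : KahlerSurface.IsKahler J) :
    ((∃ D : Π x : M, Submodule ℝ (TangentSpace (𝓡 4) x), KahlerSurface.IsQCHWith J D) ↔
      ∃ J' : Π x : M, TangentSpace (𝓡 4) x →L[ℝ] TangentSpace (𝓡 4) x,
        KahlerSurface.IsNegativeAlmostComplex J J' ∧ KahlerSurface.SecondGrayCondition J') ∧
    (∀ J' : Π x : M, TangentSpace (𝓡 4) x →L[ℝ] TangentSpace (𝓡 4) x,
      KahlerSurface.IsNegativeAlmostComplex J J' → KahlerSurface.SecondGrayCondition J' →
        KahlerSurface.IsQCHWith J (KahlerSurface.kerSub J J') ∧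
        KahlerSurface.IsQCHWith J (KahlerSurface.kerAdd J J')) ∧
    (∀ D : Π x : M, Submodule ℝ (TangentSpace (𝓡 4) x), KahlerSurface.IsQCHWith J D →
      (∃ J' : Π x : M, TangentSpace (𝓡 4) x →L[ℝ] TangentSpace (𝓡 4) x,
        KahlerSurface.IsNegativeAlmostComplex J J' ∧ KahlerSurface.SecondGrayCondition J' ∧
          D = KahlerSurface.kerSub J J') ∧
      (∃ J' : Π x : M, TangentSpace (𝓡 4) x →L[ℝ] TangentSpace (𝓡 4) x,
        KahlerSurface.IsNegativeAlmostComplex J J' ∧ KahlerSurface.SecondGrayCondition J' ∧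
          D = KahlerSurface.kerAdd J J')) := by
  have hA := hJ.toIsAlmostHermitian
  have hneg : ∀ J' : Π x : M, TangentSpace (𝓡 4) x →L[ℝ] TangentSpace (𝓡 4) x,
      KahlerSurface.SecondGrayCondition J' → KahlerSurface.SecondGrayCondition (fun x ↦ -J' x) :=
    fun J' h ↦ h.neg hJ.isKahlerCurvature
  refine ⟨⟨fun ⟨D, hD⟩ ↦ ⟨_, hD.isNegativeAlmostComplex_flip hA, hD.secondGrayCondition_flip hJ⟩,
    fun ⟨J', h, hG⟩ ↦ ⟨_, hJ.isQCHWith_kerSub h hG⟩⟩, fun J' h hG ↦ ⟨hJ.isQCHWith_kerSub h hG, ?_⟩,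
    fun D hD ↦ ⟨⟨_, hD.isNegativeAlmostComplex_flip hA, hD.secondGrayCondition_flip hJ,
      (KahlerSurface.kerSub_flip hA).symm⟩,
      ⟨_, (hD.isNegativeAlmostComplex_flip hA).neg, hneg _ (hD.secondGrayCondition_flip hJ), ?_⟩⟩⟩
  · rw [KahlerSurface.kerAdd_eq_kerSub_neg]
    exact hJ.isQCHWith_kerSub h.neg (hneg _ hG)
  · rw [KahlerSurface.kerAdd_eq_kerSub_neg]
    simp only [neg_neg]
    exact (KahlerSurface.kerSub_flip hA).symm
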